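/- Let $q\ge 1$, $b>2$ and $r$ be integers with $q<b$ and $b=qr$, and let $\mu=\mu_{q,b}$ be the Borel probability measure on $\mathbb R$ with $\mu(E)=\sum_{i=0}^{q-1}\frac1q\,\mu(f_i^{-1}(E))$ for all Borel sets $E$, where $f_i(x)=b^{-1}(x+i)$. A countable set $\Lambda\subset\mathbb R$ is a spectrum of $\mu$ if $\{e^{2\pi i\lambda x}\}_{\lambda\in\Lambda}$ is an orthonormal basis of $L^2(\mu)$. Let $\Sigma_q^*$ be the set of finite words over $\{0,\dots,q-1\}$, with empty word $\vartheta$, and let $\Gamma_q$ be the set of infinite words $I0^\infty$ with $I\in\Sigma_q^*$ either empty or with nonzero last letter; $\sigma|_k$ denotes the word of the first $k$ letters of $\sigma$. A map $\tau:\Sigma_q^*\to\{-1,0,\dots,b-2\}$ is regular on $\sigma\in\Gamma_q$ if $\tau(\sigma|_k)=0$ for all sufficiently large $k$, and irregular on $\sigma$ otherwise. It is a maximal mapping if (i) $\tau(\vartheta)=\tau(0^n)=0$ for all $n\ge1$; (ii) $\tau(\sigma_1\cdots\sigma_k)\equiv\sigma_k \pmod q$ for all $k\ge1$ and all words $\sigma_1\cdots\sigma_k$;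 (iii) for every $\sigma\in\Sigma_q^*$ there is $\sigma'\in\Sigma_q^*$ such that $\tau$ is regular on $\sigma\sigma'0^\infty$. Put $\Lambda(\tau)=\{\sum_{k\ge1}\tau(\sigma|_k)b^{k-1}:\sigma\in\Gamma_q,\ \tau\text{ regular on }\sigma\}$. A maximal mapping $\tau$ is a spectral mapping if $r\Lambda(\tau)$ is a spectrum of $\mu$. Let $\tau$ be a maximal mapping that is irregular on only finitely many $\sigma\in\Gamma_q$. Let $\tau_R$ be its regularized mapping: $\tau_R(I0^k)=0$ for all $k\ge1$ and all words $I$ with nonzero last letter such that $\tau$ is irregular on $I0^\infty$, and $\tau_R=\tau$ at all other words. Then $\tau$ is a spectral mapping if and only if $\tau_R$ is a spectral mapping. -/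

import Mathlib

open MeasureTheory ProbabilityTheory

namespace CantorSpectra

/-! ### The self-similar measure -/

/-- The coding map sending a digit sequence `ω₀ ω₁ ω₂ …` in `{0, …, q - 1}` to
`∑ ωₙ b^{-(n+1)}`. -/
noncomputable def codingMap (q b : ℕ) (ω : ℕ → Fin q) : ℝ :=
  ∑' n : ℕ, ((ω n : ℕ) : ℝ) / (b : ℝ) ^ (n + 1)

/-- The product measure on digit sequences: independent digits, uniform on `{0, …, q - 1}`. -/
noncomputable def digitMeasure (q : ℕ) [NeZero q] : Measure (ℕ → Fin q) :=
  Measure.infinitePi fun _ : ℕ => uniformOn (Set.univ : Set (Fin q))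

instance (q : ℕ) [NeZero q] : IsProbabilityMeasure (digitMeasure q) := by
  unfold digitMeasure; infer_instance

/-- The measure `μ_{q,b}`: the equal weight self-similar measure of the maps
`x ↦ (x + i) / b`, `i = 0, …, q - 1`. It is built as the law of `∑ ωₙ b^{-(n+1)}` with i.i.d.
uniform digits; see `cantorMeasure_selfSimilar` for its defining equation and
`eq_cantorMeasure` for the fact that it is the only probability measure satisfying it. -/
noncomputable def cantorMeasure (q b : ℕ) [NeZero q] : Measure ℝ :=
  (digitMeasure q).map (codingMap q b)

theorem summable_coding {q b : ℕ} (hb : 1 < b) (ω : ℕ → Fin q) :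
    Summable fun n : ℕ => ((ω n : ℕ) : ℝ) / (b : ℝ) ^ (n + 1) := by
  have hb' : (1 : ℝ) < b := by exact_mod_cast hb
  have h0 : Summable fun n : ℕ => (q : ℝ) * ((b : ℝ)⁻¹) ^ (n + 1) :=
    ((summable_nat_add_iff 1).2 (summable_geometric_of_lt_one (by positivity)
      (inv_lt_one_of_one_lt₀ hb'))).mul_left _
  refine Summable.of_nonneg_of_le (fun n => by positivity) (fun n => ?_) h0
  rw [div_eq_mul_inv, inv_pow]
  gcongr
  exact (ω n).2.le

theorem measurable_codingMap (q b : ℕ) : Measurable (codingMap q b) := by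
  unfold codingMap
  fun_prop

instance (q b : ℕ) [NeZero q] : IsProbabilityMeasure (cantorMeasure q b) :=
  Measure.isProbabilityMeasure_map (measurable_codingMap q b).aemeasurable

/-- Prepend a digit. -/
def consDigit {q : ℕ} (p : Fin q × (ℕ → Fin q)) : ℕ → Fin q
  | 0 => p.1
  | n + 1 => p.2 n

theorem measurable_consDigit {q : ℕ} : Measurable (consDigit (q := q)) := by
  refine measurable_pi_lambda _ fun n => ?_
  cases n with
  | zero => exact measurable_fst
  | succ n => exact (measurable_pi_apply n).comp measurable_snd

theorem map_consDigit (q : ℕ) [NeZero q] :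
    ((uniformOn (Set.univ : Set (Fin q))).prod (digitMeasure q)).map consDigit =
      digitMeasure q := by
  refine Measure.eq_infinitePi _ fun s t ht => ?_
  classical
  obtain ⟨N, hN⟩ : ∃ N, s ⊆ Finset.range (N + 1) := by
    obtain ⟨N, hN⟩ := s.exists_nat_subset_range
    exact ⟨N, hN.trans (Finset.range_mono (Nat.le_succ N))⟩
  let t' : ℕ → Set (Fin q) := fun i => if i ∈ s then t i else Set.univ
  have h1 : Set.pi (s : Set ℕ) t = Set.pi (Finset.range (N + 1) : Set ℕ) t' := by
    ext x
    simp only [Set.mem_pi, Finset.mem_coe, t']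
    refine ⟨fun h i _ => ?_, fun h i hi => ?_⟩
    · split_ifs with hi
      · exact h i hi
      · trivial
    · simpa [hi] using h i (hN hi)
  have h2 : ∏ i ∈ s, uniformOn (Set.univ : Set (Fin q)) (t i) =
      ∏ i ∈ Finset.range (N + 1), uniformOn (Set.univ : Set (Fin q)) (t' i) := by
    rw [← Finset.prod_subset hN]
    · exact Finset.prod_congr rfl fun i hi => by simp [t', hi]
    · intro i _ hi
      simp [t', hi]
  have h3 : consDigit ⁻¹' Set.pi (Finset.range (N + 1) : Set ℕ) t' =
      t' 0 ×ˢ Set.pi (Finset.range N : Set ℕ) fun i => t' (i + 1) := by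
    ext ⟨i, ω⟩
    simp only [Set.mem_preimage, Set.mem_pi, Finset.mem_coe, Finset.mem_range, Set.mem_prod]
    refine ⟨fun h => ⟨h 0 (by omega), fun n hn => h (n + 1) (by omega)⟩, fun h n hn => ?_⟩
    cases n with
    | zero => exact h.1
    | succ n => exact h.2 n (by omega)
  rw [Measure.map_apply measurable_consDigit (MeasurableSet.pi s.countable_toSet
    fun i _ => ht i), h1, h2, h3, Measure.prod_prod, digitMeasure, Measure.infinitePi_pi _
    (fun i _ => Set.Finite.measurableSet (Set.toFinite _)), Finset.prod_range_succ', mul_comm]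

theorem codingMap_consDigit {q b : ℕ} (hb : 1 < b) (i : Fin q) (ω : ℕ → Fin q) :
    codingMap q b (consDigit (i, ω)) = (codingMap q b ω + ((i : ℕ) : ℝ)) / b := by
  unfold codingMap
  rw [(summable_coding hb _).tsum_eq_zero_add, add_div, ← tsum_div_const, add_comm]
  have hb0 : (b : ℝ) ≠ 0 := by positivity
  congr 1
  · refine tsum_congr fun n => ?_
    simp only [consDigit]
    field_simp
    ring
  · simp [consDigit]

/-- The self-similarity equation `μ(E) = ∑ᵢ (1/q) μ(fᵢ⁻¹(E))`, `fᵢ(x) = (x + i) / b`. -/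
theorem cantorMeasure_selfSimilar (q b : ℕ) [NeZero q] (hb : 1 < b) (E : Set ℝ)
    (hE : MeasurableSet E) :
    cantorMeasure q b E =
      ∑ i : Fin q, (q : ENNReal)⁻¹ *
        cantorMeasure q b ((fun x : ℝ => (x + ((i : ℕ) : ℝ)) / b) ⁻¹' E) := by
  have hm := measurable_codingMap q b
  conv_lhs => rw [cantorMeasure, ← map_consDigit, Measure.map_map hm measurable_consDigit,
    Measure.map_apply (hm.comp measurable_consDigit) hE,
    Measure.prod_apply (hm.comp measurable_consDigit hE), lintegral_fintype]
  refine Finset.sum_congr rfl fun i _ => ?_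
  rw [mul_comm]
  congr 1
  · simp [uniformOn_univ]
  · rw [cantorMeasure, Measure.map_apply hm (by measurability)]
    congr 1
    ext ω
    simp [codingMap_consDigit hb]

/-- The self-similarity equation determines the probability measure. -/
theorem eq_cantorMeasure (q b : ℕ) [NeZero q] (hb : 1 < b) (ν : Measure ℝ)
    [IsProbabilityMeasure ν]
    (hν : ∀ E : Set ℝ, MeasurableSet E →
      ν E = ∑ i : Fin q, (q : ENNReal)⁻¹ * ν ((fun x : ℝ => (x + ((i : ℕ) : ℝ)) / b) ⁻¹' E)) :
    ν = cantorMeasure q b := by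
  have key : ∀ (κ : Measure ℝ) [IsProbabilityMeasure κ], (∀ E : Set ℝ, MeasurableSet E →
      κ E = ∑ i : Fin q, (q : ENNReal)⁻¹ * κ ((fun x : ℝ => (x + ((i : ℕ) : ℝ)) / b) ⁻¹' E)) →
      ∀ t : ℝ, charFun κ t = (∑ i : Fin q, (q : ℂ)⁻¹ *
        Complex.exp (t / b * ((i : ℕ) : ℝ) * Complex.I)) * charFun κ (t / b) := by
    intro κ _ hκ t
    have e : κ = ∑ i : Fin q, (q : ENNReal)⁻¹ • κ.map (fun x : ℝ => (x + ((i : ℕ) : ℝ)) / b) := by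
      ext E hE
      rw [hκ E hE, Measure.finsetSum_apply]
      refine Finset.sum_congr rfl fun i _ => ?_
      rw [Measure.smul_apply, Measure.map_apply (by fun_prop) hE, smul_eq_mul]
    have hi : ∀ i : Fin q, charFun (κ.map (fun x : ℝ => (x + ((i : ℕ) : ℝ)) / b)) t =
        Complex.exp (t / b * ((i : ℕ) : ℝ) * Complex.I) * charFun κ (t / b) := by
      intro i
      rw [charFun_apply_real, charFun_apply_real, integral_map (by fun_prop) (by fun_prop),
        ← integral_const_mul]
      refine integral_congr_ae (Filter.Eventually.of_forall fun x => ?_)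
      simp only
      rw [← Complex.exp_add]
      congr 1
      push_cast
      ring
    conv_lhs => rw [charFun_apply_real, e]
    rw [integral_finsetSum_measure, Finset.sum_mul]
    · refine Finset.sum_congr rfl fun i _ => ?_
      rw [integral_smul_measure, ← charFun_apply_real, hi i, mul_assoc]
      simp [Complex.real_smul, mul_assoc]
    · intro i _
      have hP := Measure.isProbabilityMeasure_map (μ := κ)
        (f := fun x : ℝ => (x + ((i : ℕ) : ℝ)) / b) (by fun_prop)
      refine Integrable.smul_measure ?_ (by simp [NeZero.ne q])
      refine Integrable.of_bound (C := 1) (by fun_prop) (Filter.Eventually.of_forall fun x => ?_)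
      rw [← Complex.ofReal_mul, Complex.norm_exp_ofReal_mul_I]
  have hq : (q : ℝ) ≠ 0 := by exact_mod_cast NeZero.ne q
  have step : ∀ t : ℝ, ‖charFun ν t - charFun (cantorMeasure q b) t‖ ≤
      ‖charFun ν (t / b) - charFun (cantorMeasure q b) (t / b)‖ := by
    intro t
    rw [key ν hν t, key _ (cantorMeasure_selfSimilar q b hb) t, ← mul_sub, norm_mul]
    refine mul_le_of_le_one_left (norm_nonneg _) ((norm_sum_le _ _).trans ?_)
    have : ∀ i : Fin q, ‖(q : ℂ)⁻¹ * Complex.exp (t / b * ((i : ℕ) : ℝ) * Complex.I)‖ =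
        (q : ℝ)⁻¹ := by
      intro i
      have h := Complex.norm_exp_ofReal_mul_I (t / b * ((i : ℕ) : ℝ))
      push_cast at h ⊢
      rw [norm_mul, h]
      simp
    rw [Finset.sum_congr rfl fun i _ => this i]
    simp [hq]
  have iter : ∀ (t : ℝ) (n : ℕ), ‖charFun ν t - charFun (cantorMeasure q b) t‖ ≤
      ‖charFun ν (t / b ^ n) - charFun (cantorMeasure q b) (t / b ^ n)‖ := by
    intro t n
    induction n with
    | zero => simp
    | succ n ih => exact ih.trans ((step _).trans_eq (by rw [div_div, ← pow_succ]))
  refine Measure.ext_of_charFun (funext fun t => ?_)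
  have hb' : (1 : ℝ) < b := by exact_mod_cast hb
  have hlim : Filter.Tendsto (fun n : ℕ => t / (b : ℝ) ^ n) Filter.atTop (nhds 0) :=
    (tendsto_pow_atTop_atTop_of_one_lt hb').const_div_atTop t
  have hc : Continuous fun s : ℝ => ‖charFun ν s - charFun (cantorMeasure q b) s‖ :=
    (continuous_charFun.sub continuous_charFun).norm
  have h0 := (hc.tendsto 0).comp hlim
  simp only [charFun_zero, probReal_univ, sub_self, norm_zero] at h0
  have := ge_of_tendsto h0 (Filter.Eventually.of_forall (iter t))
  exact sub_eq_zero.1 (norm_le_zero_iff.1 this)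

/-! ### Exponentials and spectra -/

/-- The exponential `e_s(x) = exp(2πi s x)`. -/
noncomputable def expFun (s x : ℝ) : ℂ :=
  Complex.exp (2 * Real.pi * Complex.I * s * x)

theorem memLp_expFun (μ : Measure ℝ) [IsFiniteMeasure μ] (s : ℝ) : MemLp (expFun s) 2 μ := by
  have hm : Continuous (expFun s) := by unfold expFun; fun_prop
  refine MemLp.of_bound hm.aestronglyMeasurable 1 (Filter.Eventually.of_forall fun x => ?_)
  have h := Complex.norm_exp_ofReal_mul_I (2 * Real.pi * s * x)
  rw [expFun, ← h.le.antisymm h.ge]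
  refine le_of_eq (congrArg norm (congrArg Complex.exp ?_))
  push_cast
  ring

/-- The exponential `e_s` as an element of `L²(μ)`. -/
noncomputable def expLp (μ : Measure ℝ) [IsFiniteMeasure μ] (s : ℝ) : Lp ℂ 2 μ :=
  (memLp_expFun μ s).toLp (expFun s)

/-- `S` is a spectrum of `μ`: the countable family `(e_s)_{s ∈ S}` is an orthonormal basis of
`L²(μ)`. -/
def IsSpectrum (μ : Measure ℝ) [IsFiniteMeasure μ] (S : Set ℝ) : Prop :=
  S.Countable ∧ ∃ B : HilbertBasis S ℂ (Lp ℂ 2 μ), ∀ s : S, B s = expLp μ s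

/-! ### The `q`-adic tree

Finite words over `{0, …, q - 1}` are lists (the root is `[]`), infinite words are sequences. -/

/-- The prefix `s|_k`, consisting of the first `k` letters of the infinite word `s`. -/
def prefixWord {q : ℕ} (s : ℕ → Fin q) (k : ℕ) : List (Fin q) :=
  (List.range k).map s

/-- The infinite word `I 0^∞`. -/
def zeroExtend {q : ℕ} [NeZero q] (I : List (Fin q)) : ℕ → Fin q :=
  fun n => I.getD n 0

/-- The last letter of `I`, if there is one, is nonzero. -/
def LastNonzero {q : ℕ} [NeZero q] (I : List (Fin q)) : Prop :=
  ∀ h : I ≠ [], I.getLast h ≠ 0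

/-- The set `Γ_q` of all infinite words `I 0^∞` where `I` is a finite word, empty or with nonzero
last letter. -/
def Gam (q : ℕ) [NeZero q] : Set (ℕ → Fin q) :=
  {s | ∃ I : List (Fin q), LastNonzero I ∧ s = zeroExtend I}

/-- `τ` is regular on the path `s`: `τ (s|_k) = 0` for all large `k`. -/
def RegularOn {q : ℕ} (τ : List (Fin q) → ℤ) (s : ℕ → Fin q) : Prop :=
  ∃ N : ℕ, ∀ k : ℕ, N ≤ k → τ (prefixWord s k) = 0

/-- The projection `Π(s) = ∑_{k ≥ 1} τ (s|_k) b^{k-1}`, a finite sum if `τ` is regular on `s`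
(and only used in that case). -/
noncomputable def proj {q : ℕ} (b : ℕ) (τ : List (Fin q) → ℤ) (s : ℕ → Fin q) : ℤ :=
  ∑ᶠ k : ℕ, τ (prefixWord s (k + 1)) * (b : ℤ) ^ k

/-- The digit class `C_i = (i + qℤ) ∩ {-1, 0, …, b - 2}`. -/
def digitClass (q b : ℕ) (i : Fin q) : Set ℤ :=
  {c | (∃ m : ℤ, c = ((i : ℕ) : ℤ) + q * m) ∧ c ∈ Set.Icc (-1 : ℤ) (b - 2)}

/-- Maximal mappings of the `q`-adic tree into the digits `{-1, 0, …, b - 2}`. -/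
structure IsMaximalMapping {q : ℕ} [NeZero q] (b : ℕ) (τ : List (Fin q) → ℤ) : Prop where
  mem_digits : ∀ w : List (Fin q), τ w ∈ Set.Icc (-1 : ℤ) (b - 2)
  root : τ [] = 0
  zeros : ∀ n : ℕ, 1 ≤ n → τ (List.replicate n 0) = 0
  mem_class : ∀ (w : List (Fin q)) (i : Fin q), τ (w ++ [i]) ∈ digitClass q b i
  exists_regular : ∀ w : List (Fin q), ∃ w' : List (Fin q),
    zeroExtend (w ++ w') ∈ Gam q ∧ RegularOn τ (zeroExtend (w ++ w'))

/-- The set `Λ(τ)` of all `Π(s)` where `s ∈ Γ_q` and `τ` is regular on `s`. -/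
def Lam {q : ℕ} [NeZero q] (b : ℕ) (τ : List (Fin q) → ℤ) : Set ℤ :=
  {n | ∃ s ∈ Gam q, RegularOn τ s ∧ proj b τ s = n}

/-- `τ` is a spectral mapping (with `b = q r`): it is a maximal mapping and `r Λ(τ)` is a spectrum
of `μ_{q,b}`. -/
def IsSpectralMapping {q : ℕ} [NeZero q] (r b : ℕ) (τ : List (Fin q) → ℤ) : Prop :=
  IsMaximalMapping b τ ∧
    IsSpectrum (cantorMeasure q b) ((fun n : ℤ => (r : ℝ) * (n : ℝ)) '' Lam b τ)

/-- The set of paths in `Γ_q` on which `τ` is irregular. -/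
def irregularPaths {q : ℕ} [NeZero q] (τ : List (Fin q) → ℤ) : Set (ℕ → Fin q) :=
  {s | s ∈ Gam q ∧ ¬ RegularOn τ s}

open Classical in
/-- The regularized mapping `τ_R`: it is `0` at every word `I 0^k`, `k ≥ 1`, such that `I` has
nonzero last letter and `τ` is irregular on `I 0^∞`, and equals `τ` at all other words. -/
noncomputable def regularize {q : ℕ} [NeZero q] (τ : List (Fin q) → ℤ) : List (Fin q) → ℤ :=
  fun w =>
    if ∃ (I : List (Fin q)) (k : ℕ), LastNonzero I ∧ zeroExtend I ∈ irregularPaths τ ∧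
        1 ≤ k ∧ w = I ++ List.replicate k 0
    then 0 else τ w

end CantorSpectra

open CantorSpectra

namespace CantorSpectra

open Filter Topology

/-! The Fourier transform of `μ` is an infinite product of mask factors. A finite word `w` gets as
weight the squared modulus of the first `w.length` factors, evaluated at `t` plus `r` times the
partial frequency of `w`. Since `b = q * r` and the digit after letter `i` is congruent to `i` mod
`q`, passing to a child shifts the next mask argument by `i / q`. The squared masks at these shifts
add up to one, so the weights of the children add up to the weight of the parent (`sum_wordWeight`).
Along a regular path the weights decrease to the squared Fourier transform at the frequency of that
path. By Parseval (`isSpectrum_iff`), being a spectrum means that the regular paths carry the whole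
weight of the root, for every `t`: this is `IsFull` at `[]` (`isFull_nil_iff`).

Fullness is local. The mass never exceeds the weight (`pathMass_le`), so a word is full exactly when
all its children are. It also depends only on the digits strictly below the word, because changing
earlier digits merely translates `t` (`IsFull.congr`).

The decisive point is that the single path `w 0^∞` never affects fullness of `w`
(`isFull_iff_forall_zeros`). If `τ` is regular on it, the limiting weight is exactly the mass of
that path. If `τ` is irregular on it, the limiting weight is zero
(`tendsto_wordWeight_of_not_regularOn`), because every nonzero digit on the zero tail forces the
next mask factor below a fixed constant less than one. So fullness of `w` is decided by the words `w
0^k i` with `i ≠ 0`. With finitely many irregular paths and `w` long enough, `τ` and its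
regularization agree from such words on, hence are full at the same words. The case `q = 1`, where
the mask is constant, is trivial because the two mappings coincide. -/

/-! ### The Fourier transform of the Cantor measure -/

/-- The squared modulus of the mask polynomial `q⁻¹ ∑ⱼ exp(2πi j y)`. -/
noncomputable def maskSq (q : ℕ) (y : ℝ) : ℝ :=
  ‖∑ j : Fin q, (q : ℂ)⁻¹ * Complex.exp (2 * Real.pi * y * ((j : ℕ) : ℝ) * Complex.I)‖ ^ 2

/-- The squared modulus of the Fourier transform of `μ_{q,b}`. -/
noncomputable def fourierSq (q b : ℕ) [NeZero q] (t : ℝ) : ℝ :=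
  ‖charFun (cantorMeasure q b) (2 * Real.pi * t)‖ ^ 2

/-- The squared modulus of the Fourier transform of the `n`-th level approximation of
`μ_{q,b}`. -/
noncomputable def maskProd (q b n : ℕ) (t : ℝ) : ℝ :=
  ∏ k ∈ Finset.range n, maskSq q (t / (b : ℝ) ^ (k + 1))

theorem maskSq_nonneg (q : ℕ) (y : ℝ) : 0 ≤ maskSq q y := sq_nonneg _

theorem continuous_maskSq (q : ℕ) : Continuous (maskSq q) := by
  unfold maskSq
  fun_prop

theorem norm_mask_term (q : ℕ) (y : ℝ) (j : Fin q) :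
    ‖(q : ℂ)⁻¹ * Complex.exp (2 * Real.pi * y * ((j : ℕ) : ℝ) * Complex.I)‖ = (q : ℝ)⁻¹ := by
  have h := Complex.norm_exp_ofReal_mul_I (2 * Real.pi * y * ((j : ℕ) : ℝ))
  push_cast at h ⊢
  rw [norm_mul, h]
  simp

theorem maskSq_le_one (q : ℕ) [NeZero q] (y : ℝ) : maskSq q y ≤ 1 := by
  have hq : (q : ℝ) ≠ 0 := by exact_mod_cast NeZero.ne q
  refine pow_le_one₀ (norm_nonneg _) ((norm_sum_le _ _).trans ?_)
  rw [Finset.sum_congr rfl fun j _ => norm_mask_term q y j]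
  simp [hq]

theorem maskSq_add_int (q : ℕ) (y : ℝ) (z : ℤ) : maskSq q (y + z) = maskSq q y := by
  unfold maskSq
  congr 2
  refine Finset.sum_congr rfl fun j _ => ?_
  congr 1
  rw [Complex.exp_eq_exp_iff_exists_int]
  refine ⟨z * j, ?_⟩
  push_cast
  ring

theorem sum_exp_eq_zero {q : ℕ} [NeZero q] {j k : Fin q} (h : j ≠ k) :
    ∑ i : Fin q, Complex.exp (2 * Real.pi * Complex.I * (((j : ℕ) : ℂ) - ((k : ℕ) : ℂ)) / q) ^
      (i : ℕ) = 0 := by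
  have hq : (q : ℂ) ≠ 0 := by exact_mod_cast NeZero.ne q
  set w := Complex.exp (2 * Real.pi * Complex.I * (((j : ℕ) : ℂ) - ((k : ℕ) : ℂ)) / q) with hw
  have h1 : w ≠ 1 := by
    rw [hw, Ne, Complex.exp_eq_one_iff]
    rintro ⟨n, hn⟩
    have hpi := Complex.two_pi_I_ne_zero
    have h2 : (((j : ℕ) : ℂ) - ((k : ℕ) : ℂ)) = n * q := by
      have : 2 * Real.pi * Complex.I * (((j : ℕ) : ℂ) - ((k : ℕ) : ℂ)) =
          2 * Real.pi * Complex.I * (n * q) := by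
        field_simp at hn
        linear_combination (2 * Real.pi * Complex.I) * hn
      exact mul_left_cancel₀ hpi this
    have h3 : ((j : ℕ) : ℤ) - ((k : ℕ) : ℤ) = n * q := by exact_mod_cast h2
    have hj := j.2
    have hk := k.2
    have h4 : ((j : ℕ) : ℤ) - ((k : ℕ) : ℤ) = 0 := by
      refine Int.eq_zero_of_abs_lt_dvd (m := q) ⟨n, by rw [h3, mul_comm]⟩ ?_
      rw [abs_lt]
      omega
    exact h (Fin.ext (by omega))
  have h2 : w ^ q = 1 := by
    rw [hw, ← Complex.exp_nat_mul, Complex.exp_eq_one_iff]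
    refine ⟨j - k, ?_⟩
    push_cast
    field_simp
  rw [Fin.sum_univ_eq_sum_range (fun i => w ^ i), geom_sum_eq h1, h2]
  simp

/-- Expanding the square gives a double sum over `j, k`; summing over the shifts kills the
off-diagonal terms, which are full sums of powers of a nontrivial `q`-th root of unity. -/
theorem sum_maskSq (q : ℕ) [NeZero q] (y : ℝ) :
    ∑ i : Fin q, maskSq q (y + ((i : ℕ) : ℝ) / q) = 1 := by
  have hq : (q : ℂ) ≠ 0 := by exact_mod_cast NeZero.ne q
  have key : ∀ i : Fin q, ((maskSq q (y + ((i : ℕ) : ℝ) / q) : ℝ) : ℂ) =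
      ∑ j : Fin q, ∑ k : Fin q, ((q : ℂ)⁻¹ ^ 2 *
        Complex.exp (2 * Real.pi * Complex.I * y * (((j : ℕ) : ℂ) - ((k : ℕ) : ℂ)))) *
        Complex.exp (2 * Real.pi * Complex.I * (((j : ℕ) : ℂ) - ((k : ℕ) : ℂ)) / q) ^
          (i : ℕ) := by
    intro i
    unfold maskSq
    rw [Complex.ofReal_pow, ← Complex.mul_conj', map_sum, Finset.sum_mul_sum]
    refine Finset.sum_congr rfl fun j _ => Finset.sum_congr rfl fun k _ => ?_
    rw [map_mul, ← Complex.exp_conj, ← Complex.exp_nat_mul]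
    simp only [map_mul, Complex.conj_ofReal, Complex.conj_I, map_inv₀, map_natCast, map_ofNat]
    rw [mul_mul_mul_comm, ← Complex.exp_add, mul_assoc ((q : ℂ)⁻¹ ^ 2), ← Complex.exp_add, pow_two]
    congr 2
    push_cast
    field_simp
    ring
  have : ((∑ i : Fin q, maskSq q (y + ((i : ℕ) : ℝ) / q) : ℝ) : ℂ) = 1 := by
    rw [Complex.ofReal_sum, Finset.sum_congr rfl fun i _ => key i, Finset.sum_comm]
    have hj : ∀ j : Fin q, ∑ i : Fin q, ∑ k : Fin q, ((q : ℂ)⁻¹ ^ 2 *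
        Complex.exp (2 * Real.pi * Complex.I * y * (((j : ℕ) : ℂ) - ((k : ℕ) : ℂ)))) *
        Complex.exp (2 * Real.pi * Complex.I * (((j : ℕ) : ℂ) - ((k : ℕ) : ℂ)) / q) ^
          (i : ℕ) = (q : ℂ)⁻¹ := by
      intro j
      rw [Finset.sum_comm, Finset.sum_eq_single j]
      · simp
        field_simp
      · intro k _ hk
        rw [← Finset.mul_sum, sum_exp_eq_zero hk.symm, mul_zero]
      · simp
    rw [Finset.sum_congr rfl fun j _ => hj j]
    simp [hq]
  exact_mod_cast this

/-- The terms `j = 0` and `j = 1` already have different directions for noninteger `y`, so the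
triangle inequality is strict. -/
theorem maskSq_lt_one {q : ℕ} (hq : 2 ≤ q) {y : ℝ} (h0 : 0 < y) (h1 : y < 1) :
    maskSq q y < 1 := by
  have hne : NeZero q := ⟨by omega⟩
  let f : ℕ → ℂ := fun j => (q : ℂ)⁻¹ * Complex.exp (2 * Real.pi * y * (j : ℝ) * Complex.I)
  have hf : ∀ j, ‖f j‖ = (q : ℝ)⁻¹ := by
    intro j
    have h := Complex.norm_exp_ofReal_mul_I (2 * Real.pi * y * (j : ℝ))
    simp only [f]
    push_cast at h ⊢
    rw [norm_mul, h]
    simp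
  have hqp : (0 : ℝ) < (q : ℝ)⁻¹ := by positivity
  have h01 : ‖f 0 + f 1‖ < 2 * (q : ℝ)⁻¹ := by
    have hlt : ‖f 0 + f 1‖ < ‖f 0‖ + ‖f 1‖ := by
      refine lt_of_le_of_ne (norm_add_le _ _) fun h => ?_
      have h2 := (sameRay_iff_norm_add.2 h)
      have h3 : f 0 = f 1 := (h2.norm_eq_iff).1 (by rw [hf, hf])
      have h4 : Complex.exp (2 * Real.pi * y * Complex.I) = 1 := by
        have hqc : (q : ℂ)⁻¹ ≠ 0 := inv_ne_zero (by exact_mod_cast NeZero.ne q)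
        have := mul_left_cancel₀ hqc h3
        simpa using this.symm
      obtain ⟨n, hn⟩ := Complex.exp_eq_one_iff.1 h4
      have h5 : (2 * Real.pi * Complex.I) * (y : ℂ) = 2 * Real.pi * Complex.I * (n : ℂ) := by
        linear_combination hn
      have h6 : y = n := by exact_mod_cast mul_left_cancel₀ Complex.two_pi_I_ne_zero h5
      rw [h6] at h0 h1
      norm_cast at h0 h1
      omega
    rw [hf, hf] at hlt
    linarith
  have hs : ∑ j : Fin q, f j = (f 0 + f 1) + ∑ j ∈ Finset.Ico 2 q, f j := by
    rw [Fin.sum_univ_eq_sum_range f, ← Finset.sum_range_add_sum_Ico f hq]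
    simp [Finset.sum_range_succ]
  have hle : ‖∑ j : Fin q, f j‖ < 1 := by
    rw [hs]
    calc _ ≤ ‖f 0 + f 1‖ + ∑ j ∈ Finset.Ico 2 q, ‖f j‖ :=
          (norm_add_le _ _).trans (add_le_add_right (norm_sum_le _ _) _)
      _ < 2 * (q : ℝ)⁻¹ + ∑ j ∈ Finset.Ico 2 q, ‖f j‖ := by gcongr
      _ = 1 := by
        rw [Finset.sum_congr rfl fun j _ => hf j]
        simp only [Finset.sum_const, Nat.card_Ico, nsmul_eq_mul, Nat.cast_sub hq]
        have : (q : ℝ) ≠ 0 := by positivity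
        field_simp
        push_cast
        ring
  exact pow_lt_one₀ (norm_nonneg _) hle two_ne_zero

theorem fourierSq_nonneg (q b : ℕ) [NeZero q] (t : ℝ) : 0 ≤ fourierSq q b t := sq_nonneg _

theorem fourierSq_le_one (q b : ℕ) [NeZero q] (t : ℝ) : fourierSq q b t ≤ 1 :=
  pow_le_one₀ (norm_nonneg _) (norm_charFun_le_one _)

theorem fourierSq_zero (q b : ℕ) [NeZero q] : fourierSq q b 0 = 1 := by
  simp [fourierSq]

theorem continuous_fourierSq (q b : ℕ) [NeZero q] : Continuous (fourierSq q b) := by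
  unfold fourierSq
  exact ((continuous_charFun.comp (continuous_const.mul continuous_id)).norm).pow 2

theorem charFun_cantorMeasure (q b : ℕ) [NeZero q] (hb : 1 < b) (t : ℝ) :
    charFun (cantorMeasure q b) t = (∑ i : Fin q, (q : ℂ)⁻¹ *
        Complex.exp (t / b * ((i : ℕ) : ℝ) * Complex.I)) *
      charFun (cantorMeasure q b) (t / b) := by
  have e : cantorMeasure q b = ∑ i : Fin q, (q : ENNReal)⁻¹ •
      (cantorMeasure q b).map (fun x : ℝ => (x + ((i : ℕ) : ℝ)) / b) := by
    ext E hE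
    rw [cantorMeasure_selfSimilar q b hb E hE, Measure.finsetSum_apply]
    refine Finset.sum_congr rfl fun i _ => ?_
    rw [Measure.smul_apply, Measure.map_apply (by fun_prop) hE, smul_eq_mul]
  have hi : ∀ i : Fin q,
      charFun ((cantorMeasure q b).map (fun x : ℝ => (x + ((i : ℕ) : ℝ)) / b)) t =
      Complex.exp (t / b * ((i : ℕ) : ℝ) * Complex.I) *
        charFun (cantorMeasure q b) (t / b) := by
    intro i
    rw [charFun_apply_real, charFun_apply_real, integral_map (by fun_prop) (by fun_prop),
      ← integral_const_mul]
    refine integral_congr_ae (Filter.Eventually.of_forall fun x => ?_)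
    simp only
    rw [← Complex.exp_add]
    congr 1
    push_cast
    ring
  conv_lhs => rw [charFun_apply_real, e]
  rw [integral_finsetSum_measure, Finset.sum_mul]
  · refine Finset.sum_congr rfl fun i _ => ?_
    rw [integral_smul_measure, ← charFun_apply_real, hi i, mul_assoc]
    simp [mul_assoc]
  · intro i _
    have hP := Measure.isProbabilityMeasure_map (μ := cantorMeasure q b)
      (f := fun x : ℝ => (x + ((i : ℕ) : ℝ)) / b) (by fun_prop)
    refine Integrable.smul_measure ?_ (by simp [NeZero.ne q])
    refine Integrable.of_bound (C := 1) (by fun_prop) (Filter.Eventually.of_forall fun x => ?_)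
    rw [← Complex.ofReal_mul, Complex.norm_exp_ofReal_mul_I]

theorem fourierSq_eq_mul {q b : ℕ} [NeZero q] (hb : 1 < b) (t : ℝ) :
    fourierSq q b t = maskSq q (t / b) * fourierSq q b (t / b) := by
  unfold fourierSq maskSq
  rw [charFun_cantorMeasure q b hb, norm_mul, mul_pow, mul_div_assoc]
  congr 3
  refine Finset.sum_congr rfl fun i _ => ?_
  push_cast
  ring_nf

theorem maskProd_nonneg (q b n : ℕ) (t : ℝ) : 0 ≤ maskProd q b n t :=
  Finset.prod_nonneg fun _ _ => maskSq_nonneg _ _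

theorem maskProd_succ (q b n : ℕ) (t : ℝ) :
    maskProd q b (n + 1) t = maskProd q b n t * maskSq q (t / (b : ℝ) ^ (n + 1)) :=
  Finset.prod_range_succ _ _

theorem fourierSq_eq_maskProd_mul {q b : ℕ} [NeZero q] (hb : 1 < b) (n : ℕ) (t : ℝ) :
    fourierSq q b t = maskProd q b n t * fourierSq q b (t / (b : ℝ) ^ n) := by
  induction n with
  | zero => simp [maskProd]
  | succ n ih =>
    rw [ih, maskProd_succ, fourierSq_eq_mul hb (t / (b : ℝ) ^ n), div_div, ← pow_succ, mul_assoc]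

/-- Every one of the first `n` mask arguments moves by an integer. Hence the weight of a word of
length `n` sees frequencies only modulo `b ^ n`. -/
theorem maskProd_add_mul {q b : ℕ} (hb : 1 < b) (n : ℕ) (t : ℝ) (z : ℤ) :
    maskProd q b n (t + (b : ℝ) ^ n * z) = maskProd q b n t := by
  refine Finset.prod_congr rfl fun k hk => ?_
  have hk' : n = (n - (k + 1)) + (k + 1) := by
    have := Finset.mem_range.1 hk
    omega
  have hb0 : (b : ℝ) ≠ 0 := by positivity
  have : (t + (b : ℝ) ^ n * z) / (b : ℝ) ^ (k + 1) =
      t / (b : ℝ) ^ (k + 1) + ((b ^ (n - (k + 1)) * z : ℤ) : ℝ) := by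
    rw [add_div]
    congr 1
    conv_lhs => rw [hk', pow_add]
    push_cast
    field_simp
  rw [this, maskSq_add_int]

theorem tendsto_div_pow {b : ℕ} (hb : 1 < b) (t : ℝ) :
    Tendsto (fun n : ℕ => t / (b : ℝ) ^ n) atTop (𝓝 0) :=
  (tendsto_pow_atTop_atTop_of_one_lt (by exact_mod_cast hb)).const_div_atTop t

theorem tendsto_maskProd {q b : ℕ} [NeZero q] (hb : 1 < b) (t : ℝ) :
    Tendsto (fun n => maskProd q b n t) atTop (𝓝 (fourierSq q b t)) := by
  have h1 : Tendsto (fun n : ℕ => fourierSq q b (t / (b : ℝ) ^ n)) atTop (𝓝 1) := by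
    have := ((continuous_fourierSq q b).tendsto 0).comp (tendsto_div_pow hb t)
    rwa [fourierSq_zero] at this
  -- The quotient is the partial product as soon as the tail factor is nonzero, which holds
  -- eventually since that factor tends to one.
  have h2 : Tendsto (fun n : ℕ => fourierSq q b t / fourierSq q b (t / (b : ℝ) ^ n)) atTop
      (𝓝 (fourierSq q b t / 1)) := tendsto_const_nhds.div h1 one_ne_zero
  rw [div_one] at h2
  refine h2.congr' ?_
  filter_upwards [h1.eventually_ne one_ne_zero] with n hn
  rw [fourierSq_eq_maskProd_mul hb n t]
  field_simp

/-! ### The Parseval criterion -/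

theorem conj_expFun (s x : ℝ) : (starRingEnd ℂ) (expFun s x) = expFun (-s) x := by
  unfold expFun
  rw [← Complex.exp_conj]
  simp only [map_mul, Complex.conj_ofReal, Complex.conj_I, map_ofNat]
  congr 1
  push_cast
  ring

theorem inner_expLp_left (μ : Measure ℝ) [IsFiniteMeasure μ] (s : ℝ) (f : Lp ℂ 2 μ) :
    inner ℂ (expLp μ s) f = ∫ x, expFun (-s) x * f x ∂μ := by
  rw [L2.inner_def]
  refine integral_congr_ae ?_
  filter_upwards [(memLp_expFun μ s).coeFn_toLp] with x hx
  rw [expLp, hx, RCLike.inner_apply, conj_expFun, mul_comm]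

theorem inner_expLp (μ : Measure ℝ) [IsFiniteMeasure μ] (s t : ℝ) :
    inner ℂ (expLp μ s) (expLp μ t) = charFun μ (2 * Real.pi * (t - s)) := by
  rw [inner_expLp_left, charFun_apply_real]
  refine integral_congr_ae ?_
  filter_upwards [(memLp_expFun μ t).coeFn_toLp] with x hx
  rw [expLp, hx, expFun, expFun, ← Complex.exp_add]
  congr 1
  push_cast
  ring

/-- The positive and negative parts of `g` are densities of two finite measures with the same
characteristic function; the measures agree, hence so do the densities. -/
theorem ae_eq_zero_of_forall_integral_exp_eq_zero_real {μ : Measure ℝ} [IsFiniteMeasure μ]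
    {g : ℝ → ℝ} (hg : Integrable g μ)
    (h : ∀ t : ℝ, ∫ x, Complex.exp (t * x * Complex.I) * (g x : ℂ) ∂μ = 0) : g =ᵐ[μ] 0 := by
  have hp := hg.pos_part
  have hn := hg.neg_part
  have fin : ∀ {u : ℝ → ℝ}, Integrable u μ →
      IsFiniteMeasure (μ.withDensity fun x => ENNReal.ofReal (u x)) := fun hu =>
    isFiniteMeasure_withDensity_ofReal hu.2
  have f1 := fin hp
  have f2 := fin hn
  have hchar : ∀ (u : ℝ → ℝ), Integrable u μ → (∀ x, 0 ≤ u x) → ∀ t : ℝ,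
      charFun (μ.withDensity fun x => ENNReal.ofReal (u x)) t =
        ∫ x, Complex.exp (t * x * Complex.I) * (u x : ℂ) ∂μ := by
    intro u hu hu0 t
    rw [charFun_apply_real, integral_withDensity_eq_integral_toReal_smul₀
      hu.1.aemeasurable.ennreal_ofReal (by simp)]
    refine integral_congr_ae (Eventually.of_forall fun x => ?_)
    simp only [ENNReal.toReal_ofReal (hu0 x), Complex.real_smul]
    ring
  have hint : ∀ (u : ℝ → ℝ), Integrable u μ → ∀ t : ℝ,
      Integrable (fun x : ℝ => Complex.exp (t * x * Complex.I) * (u x : ℂ)) μ := by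
    intro u hu t
    refine hu.ofReal.bdd_mul (c := 1) (by fun_prop) (Eventually.of_forall fun x => ?_)
    rw [← Complex.ofReal_mul, Complex.norm_exp_ofReal_mul_I]
  have heq : (μ.withDensity fun x => ENNReal.ofReal (max (g x) 0)) =
      μ.withDensity fun x => ENNReal.ofReal (max (-g x) 0) := by
    refine Measure.ext_of_charFun (funext fun t => ?_)
    rw [hchar _ hp (fun x => le_max_right _ _), hchar _ hn (fun x => le_max_right _ _),
      ← sub_eq_zero, ← integral_sub (hint _ hp t) (hint _ hn t), ← h t]
    refine integral_congr_ae (Eventually.of_forall fun x => ?_)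
    simp only
    rw [← mul_sub, ← Complex.ofReal_sub, max_zero_sub_max_neg_zero_eq_self]
  have hae := (withDensity_eq_iff hp.1.aemeasurable.ennreal_ofReal
    hn.1.aemeasurable.ennreal_ofReal ((lintegral_ofReal_ne_top_iff_integrable hp.1
      (Eventually.of_forall fun x => le_max_right _ _)).2 hp)).1 heq
  filter_upwards [hae] with x hx
  have h1 := (ENNReal.ofReal_eq_ofReal_iff (le_max_right _ _) (le_max_right _ _)).1 hx
  have h2 := max_zero_sub_max_neg_zero_eq_self (g x)
  simp only [Pi.zero_apply]
  linarith

theorem eq_zero_of_forall_inner_expLp_eq_zero {μ : Measure ℝ} [IsFiniteMeasure μ]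
    (f : Lp ℂ 2 μ) (h : ∀ s : ℝ, inner ℂ (expLp μ s) f = 0) : f = 0 := by
  have hf : Integrable f μ := (Lp.memLp f).integrable one_le_two
  have hexp : ∀ t : ℝ, ∀ x : ℝ,
      Complex.exp (t * x * Complex.I) = expFun (-(-(t / (2 * Real.pi)))) x := by
    intro t x
    unfold expFun
    congr 1
    have : (Real.pi : ℂ) ≠ 0 := by exact_mod_cast Real.pi_ne_zero
    push_cast
    field_simp
  have h1 : ∀ t : ℝ, ∫ x, Complex.exp (t * x * Complex.I) * f x ∂μ = 0 := by
    intro t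
    simp_rw [hexp]
    rw [← inner_expLp_left, h]
  have h2 : ∀ t : ℝ, ∫ x, Complex.exp (t * x * Complex.I) * (starRingEnd ℂ) (f x) ∂μ = 0 := by
    intro t
    rw [← map_zero (starRingEnd ℂ), ← h1 (-t), ← integral_conj]
    refine integral_congr_ae (Eventually.of_forall fun x => ?_)
    simp only [map_mul, ← Complex.exp_conj]
    simp
  have hint : ∀ (u : ℝ → ℂ), Integrable u μ → ∀ t : ℝ,
      Integrable (fun x : ℝ => Complex.exp (t * x * Complex.I) * u x) μ := by
    intro u hu t
    refine hu.bdd_mul (c := 1) (by fun_prop) (Eventually.of_forall fun x => ?_)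
    rw [← Complex.ofReal_mul, Complex.norm_exp_ofReal_mul_I]
  have hfc : Integrable (fun x => (starRingEnd ℂ) (f x)) μ :=
    (LinearIsometryEquiv.integrable_comp_iff Complex.conjLIE).2 hf
  have hre := ae_eq_zero_of_forall_integral_exp_eq_zero_real hf.re fun t => by
    have : (fun x : ℝ => Complex.exp (t * x * Complex.I) * ((RCLike.re (f x) : ℝ) : ℂ)) =
        fun x : ℝ => (1 / 2 : ℂ) * (Complex.exp (t * x * Complex.I) * f x +
          Complex.exp (t * x * Complex.I) * (starRingEnd ℂ) (f x)) := by
      funext x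
      rw [← mul_add, Complex.add_conj]
      simp
      ring
    rw [this, integral_const_mul, integral_add (hint _ hf t) (hint _ hfc t), h1, h2]
    simp
  have him := ae_eq_zero_of_forall_integral_exp_eq_zero_real hf.im fun t => by
    have : (fun x : ℝ => Complex.exp (t * x * Complex.I) * ((RCLike.im (f x) : ℝ) : ℂ)) =
        fun x : ℝ => (-Complex.I / 2 : ℂ) * (Complex.exp (t * x * Complex.I) * f x -
          Complex.exp (t * x * Complex.I) * (starRingEnd ℂ) (f x)) := by
      funext x
      rw [← mul_sub, Complex.sub_conj]
      simp
      linear_combination (Complex.exp (t * x * Complex.I) * ((f x).im : ℂ)) * Complex.I_sq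
    rw [this, integral_const_mul, integral_sub (hint _ hf t) (hint _ hfc t), h1, h2]
    simp
  rw [Lp.eq_zero_iff_ae_eq_zero]
  filter_upwards [hre, him] with x hx hy
  exact Complex.ext hx hy

/-- Equality in Bessel's inequality makes `x` the sum of its own expansion in `v`, so whatever is
orthogonal to `v` is orthogonal to `x`. -/
theorem inner_eq_zero_of_hasSum_norm_sq {ι E : Type*} [NormedAddCommGroup E]
    [InnerProductSpace ℂ E] {v : ι → E} (hv : Orthonormal ℂ v) {x f : E}
    (hx : HasSum (fun i => ‖inner ℂ (v i) x‖ ^ 2) (‖x‖ ^ 2))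
    (hf : ∀ i, inner ℂ (v i) f = 0) : inner ℂ x f = 0 := by
  classical
  have hs : HasSum (fun i => inner ℂ (v i) x • v i) x := by
    rw [HasSum, tendsto_iff_norm_sub_tendsto_zero]
    have h1 : ∀ s : Finset ι, ‖∑ i ∈ s, inner ℂ (v i) x • v i - x‖ ^ 2 =
        ‖x‖ ^ 2 - ∑ i ∈ s, ‖inner ℂ (v i) x‖ ^ 2 := by
      intro s
      set p := ∑ i ∈ s, inner ℂ (v i) x • v i with hp
      have hpp : inner ℂ p p = ((∑ i ∈ s, ‖inner ℂ (v i) x‖ ^ 2 : ℝ) : ℂ) := by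
        rw [hp, hv.inner_sum]
        push_cast
        exact Finset.sum_congr rfl fun i _ => Complex.conj_mul' _
      have hpx : inner ℂ p x = ((∑ i ∈ s, ‖inner ℂ (v i) x‖ ^ 2 : ℝ) : ℂ) := by
        rw [hp, sum_inner]
        push_cast
        refine Finset.sum_congr rfl fun i _ => ?_
        rw [inner_smul_left, Complex.conj_mul']
      have hn : ‖p‖ ^ 2 = ∑ i ∈ s, ‖inner ℂ (v i) x‖ ^ 2 := by
        have := inner_self_eq_norm_sq_to_K (𝕜 := ℂ) p
        rw [hpp] at this
        exact Complex.ofReal_injective (by push_cast at this ⊢; exact this.symm)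
      have := @norm_sub_sq ℂ E _ _ _ p x
      rw [hpx, hn] at this
      rw [this]
      simp only [RCLike.re_to_complex, Complex.ofReal_re]
      ring
    have h2 : Tendsto (fun s : Finset ι => ‖∑ i ∈ s, inner ℂ (v i) x • v i - x‖ ^ 2) atTop
        (𝓝 0) := by
      simp_rw [h1]
      have := (tendsto_const_nhds (x := ‖x‖ ^ 2)).sub hx
      rwa [sub_self] at this
    have h3 := h2.sqrt
    simpa using h3
  have h4 := hs.mapL (innerSL ℂ f)
  simp only [innerSL_apply_apply, inner_smul_right] at h4
  have h5 : ∀ i, inner ℂ (v i) x * inner ℂ f (v i) = 0 := fun i => by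
    rw [← inner_conj_symm f, hf, map_zero, mul_zero]
  simp_rw [h5] at h4
  rw [← inner_conj_symm, h4.unique hasSum_zero, map_zero]

/-- The sum is Parseval's identity for the exponential of frequency `-t`. Conversely, these
identities place every exponential in the closed span of the family, and the exponentials together
are total in `L²`. -/
theorem isSpectrum_iff {q b : ℕ} [NeZero q] {S : Set ℝ} (hS : S.Countable) :
    IsSpectrum (cantorMeasure q b) S ↔
      ∀ t : ℝ, ∑' s : S, ENNReal.ofReal (fourierSq q b (t + s)) = 1 := by
  have hin : ∀ s t : ℝ, ‖inner ℂ (expLp (cantorMeasure q b) s) (expLp (cantorMeasure q b) (-t))‖ ^ 2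
      = fourierSq q b (t + s) := by
    intro s t
    rw [inner_expLp, fourierSq, show 2 * Real.pi * (-t - s) = -(2 * Real.pi * (t + s)) by ring,
      charFun_neg, RCLike.norm_conj]
  have hnorm : ∀ s : ℝ, ‖expLp (cantorMeasure q b) s‖ = 1 := by
    intro s
    have h := hin s (-s)
    rw [neg_neg, neg_add_cancel, fourierSq_zero, inner_self_eq_norm_sq_to_K] at h
    have h2 : ‖expLp (cantorMeasure q b) s‖ ^ 4 = 1 := by
      rw [← h]
      simp [← pow_mul]
    exact (pow_eq_one_iff_of_nonneg (norm_nonneg _) (by norm_num)).1 h2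
  constructor
  · rintro ⟨-, B, hB⟩ t
    have h := B.hasSum_inner_mul_inner (expLp (cantorMeasure q b) (-t))
      (expLp (cantorMeasure q b) (-t))
    have h2 : HasSum (fun s : S => fourierSq q b (t + s)) 1 := by
      rw [inner_self_eq_norm_sq_to_K, hnorm] at h
      have h3 : ∀ s : S, inner ℂ (expLp (cantorMeasure q b) (-t)) (B s) *
          inner ℂ (B s) (expLp (cantorMeasure q b) (-t)) = ((fourierSq q b (t + s) : ℝ) : ℂ) := by
        intro s
        rw [← inner_conj_symm, Complex.conj_mul', hB, ← hin]
        push_cast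
        rfl
      simp_rw [h3] at h
      have h4 : HasSum (fun s : S => ((fourierSq q b (t + s) : ℝ) : ℂ)) ((1 : ℝ) : ℂ) := by
        simpa using h
      exact_mod_cast h4
    rw [← ENNReal.ofReal_tsum_of_nonneg (fun _ => fourierSq_nonneg _ _ _) h2.summable,
      h2.tsum_eq, ENNReal.ofReal_one]
  · intro h
    have hsum : ∀ t : ℝ, HasSum (fun s : S => fourierSq q b (t + s)) 1 := by
      intro t
      have h1 := ENNReal.hasSum_toReal (by rw [h t]; exact ENNReal.one_ne_top)
        (f := fun s : S => ENNReal.ofReal (fourierSq q b (t + s)))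
      rw [← ENNReal.tsum_toReal_eq (fun _ => ENNReal.ofReal_ne_top), h t] at h1
      simpa only [ENNReal.toReal_ofReal (fourierSq_nonneg _ _ _), ENNReal.toReal_one] using h1
    have horth : Orthonormal ℂ fun s : S => expLp (cantorMeasure q b) s := by
      refine ⟨fun s => hnorm s, fun s u hsu => ?_⟩
      -- At `t = -u` the term of `u` alone equals one, so every other term vanishes: orthogonality
      -- comes for free.
      have h1 := (hsum (-(u : ℝ)))
      have h2 := sum_le_hasSum {s, u} (fun i _ => fourierSq_nonneg _ _ _) h1
      rw [Finset.sum_pair hsu, neg_add_cancel, fourierSq_zero] at h2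
      have h3 : fourierSq q b (-(u : ℝ) + s) = 0 :=
        le_antisymm (by linarith) (fourierSq_nonneg _ _ _)
      rw [← hin, neg_neg] at h3
      exact norm_eq_zero.1 (pow_eq_zero_iff two_ne_zero |>.1 h3)
    have hbot : (Submodule.span ℂ (Set.range fun s : S => expLp (cantorMeasure q b) s))ᗮ = ⊥ := by
      rw [Submodule.eq_bot_iff]
      intro f hf
      refine eq_zero_of_forall_inner_expLp_eq_zero f fun t => ?_
      refine inner_eq_zero_of_hasSum_norm_sq horth (x := expLp (cantorMeasure q b) t) ?_
        fun s => ?_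
      · have := hsum (-t)
        simp_rw [← hin, neg_neg] at this
        rwa [hnorm, one_pow]
      · exact (Submodule.mem_orthogonal _ _).1 hf _ (Submodule.subset_span ⟨s, rfl⟩)
    refine ⟨hS, HilbertBasis.mkOfOrthogonalEqBot horth hbot, fun s => ?_⟩
    rw [HilbertBasis.coe_mkOfOrthogonalEqBot]

/-! ### Partial frequencies along words -/

variable {q : ℕ}

/-- The partial frequency `∑ τ(w|_{k+1}) b^k` collected along the finite word `w`. -/
def wordFreq (b : ℕ) (τ : List (Fin q) → ℤ) (w : List (Fin q)) : ℤ :=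
  ∑ k ∈ Finset.range w.length, τ (w.take (k + 1)) * (b : ℤ) ^ k

theorem wordFreq_concat (b : ℕ) (τ : List (Fin q) → ℤ) (w : List (Fin q)) (i : Fin q) :
    wordFreq b τ (w ++ [i]) = wordFreq b τ w + τ (w ++ [i]) * (b : ℤ) ^ w.length := by
  unfold wordFreq
  rw [List.length_append, List.length_singleton, Finset.sum_range_succ]
  congr 1
  · refine Finset.sum_congr rfl fun k hk => ?_
    rw [List.take_append_of_le_length (Finset.mem_range.1 hk)]
  · rw [List.take_of_length_le (by simp)]

theorem length_prefixWord (s : ℕ → Fin q) (n : ℕ) : (prefixWord s n).length = n := by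
  simp [prefixWord]

theorem prefixWord_succ (s : ℕ → Fin q) (n : ℕ) :
    prefixWord s (n + 1) = prefixWord s n ++ [s n] := by
  simp [prefixWord, List.range_succ]

theorem take_prefixWord (s : ℕ → Fin q) {k n : ℕ} (h : k ≤ n) :
    (prefixWord s n).take k = prefixWord s k := by
  simp [prefixWord, ← List.map_take, List.take_range, h]

theorem prefixWord_inj {s t : ℕ → Fin q} {n : ℕ} :
    prefixWord s n = prefixWord t n ↔ ∀ k < n, s k = t k := by
  simp [prefixWord]

theorem wordFreq_prefixWord (b : ℕ) (τ : List (Fin q) → ℤ) (s : ℕ → Fin q) (n : ℕ) :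
    wordFreq b τ (prefixWord s n) =
      ∑ k ∈ Finset.range n, τ (prefixWord s (k + 1)) * (b : ℤ) ^ k := by
  unfold wordFreq
  rw [length_prefixWord]
  refine Finset.sum_congr rfl fun k hk => ?_
  rw [take_prefixWord s (Finset.mem_range.1 hk)]

theorem proj_eq_wordFreq {b : ℕ} {τ : List (Fin q) → ℤ} {s : ℕ → Fin q} {n : ℕ}
    (h : ∀ k, n ≤ k → τ (prefixWord s (k + 1)) = 0) :
    proj b τ s = wordFreq b τ (prefixWord s n) := by
  rw [wordFreq_prefixWord, proj]
  refine finsum_eq_sum_of_support_subset _ fun k hk => ?_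
  by_contra hk'
  simp only [Finset.coe_range, Set.mem_Iio, not_lt] at hk'
  exact hk (by simp [h k hk'])

theorem RegularOn.exists_proj_eq {b : ℕ} {τ : List (Fin q) → ℤ} {s : ℕ → Fin q}
    (h : RegularOn τ s) :
    ∃ N, ∀ n, N ≤ n → proj b τ s = wordFreq b τ (prefixWord s n) := by
  obtain ⟨N, hN⟩ := h
  exact ⟨N, fun n hn => proj_eq_wordFreq fun k hk => hN _ (by omega)⟩

theorem dvd_wordFreq_sub (b : ℕ) (τ : List (Fin q) → ℤ) (s : ℕ → Fin q) {m n : ℕ} (h : m ≤ n) :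
    (b : ℤ) ^ m ∣ wordFreq b τ (prefixWord s n) - wordFreq b τ (prefixWord s m) := by
  rw [wordFreq_prefixWord, wordFreq_prefixWord, ← Finset.sum_range_add_sum_Ico _ h,
    add_sub_cancel_left]
  exact Finset.dvd_sum fun k hk => Dvd.dvd.mul_left (pow_dvd_pow _ (Finset.mem_Ico.1 hk).1) _

theorem RegularOn.exists_proj_eq_add {b : ℕ} {τ : List (Fin q) → ℤ} {s : ℕ → Fin q}
    (h : RegularOn τ s) (n : ℕ) :
    ∃ z : ℤ, proj b τ s = wordFreq b τ (prefixWord s n) + (b : ℤ) ^ n * z := by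
  obtain ⟨N, hN⟩ := h.exists_proj_eq (b := b)
  obtain ⟨z, hz⟩ := dvd_wordFreq_sub b τ s (le_max_right N n)
  exact ⟨z, by rw [hN _ (le_max_left N n), ← hz]; ring⟩

/-! ### Mass below a word -/

/-- The mass which the tree mapping assigns to the cylinder of `w`. -/
noncomputable def wordWeight (r b : ℕ) (τ : List (Fin q) → ℤ) (w : List (Fin q)) (t : ℝ) : ℝ :=
  maskProd q b w.length (t + r * wordFreq b τ w)

open Classical in
/-- The part of that mass which is carried by the frequencies of regular paths through `w`. -/
noncomputable def pathMass [NeZero q] (r b : ℕ) (τ : List (Fin q) → ℤ) (w : List (Fin q))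
    (t : ℝ) : ENNReal :=
  ∑' s : ℕ → Fin q, if (s ∈ Gam q ∧ RegularOn τ s) ∧ prefixWord s w.length = w then
    ENNReal.ofReal (fourierSq q b (t + r * proj b τ s)) else 0

/-- The regular paths through `w` carry the whole mass of the cylinder of `w`. -/
def IsFull [NeZero q] (r b : ℕ) (τ : List (Fin q) → ℤ) (w : List (Fin q)) : Prop :=
  ∀ t : ℝ, pathMass r b τ w t = ENNReal.ofReal (wordWeight r b τ w t)

theorem wordWeight_nonneg (r b : ℕ) (τ : List (Fin q) → ℤ) (w : List (Fin q)) (t : ℝ) :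
    0 ≤ wordWeight r b τ w t := maskProd_nonneg _ _ _ _

theorem wordWeight_nil (r b : ℕ) (τ : List (Fin q) → ℤ) (t : ℝ) : wordWeight r b τ [] t = 1 := by
  simp [wordWeight, maskProd]

/-- The new digit changes the frequency by a multiple of `b ^ w.length`, which the old factors
ignore. In the new factor it contributes `r / b = 1 / q` times itself, so only its class mod `q`
counts. -/
theorem wordWeight_concat [NeZero q] {r b : ℕ} (hb : 1 < b) (hbqr : b = q * r)
    {τ : List (Fin q) → ℤ} (w : List (Fin q)) (i : Fin q) {d : ℕ}
    (hd : ∃ m : ℤ, τ (w ++ [i]) = d + q * m) (t : ℝ) :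
    wordWeight r b τ (w ++ [i]) t = wordWeight r b τ w t *
      maskSq q ((t + r * wordFreq b τ w) / (b : ℝ) ^ (w.length + 1) + (d : ℝ) / q) := by
  obtain ⟨m, hm⟩ := hd
  have hq : (q : ℝ) ≠ 0 := by exact_mod_cast NeZero.ne q
  have hb0 : (b : ℝ) ≠ 0 := by positivity
  have hbr : (b : ℝ) = q * r := by exact_mod_cast hbqr
  unfold wordWeight
  rw [List.length_append, List.length_singleton, maskProd_succ, wordFreq_concat]
  congr 1
  · refine Eq.trans (congrArg _ ?_) (maskProd_add_mul hb w.length _ (r * τ (w ++ [i])))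
    push_cast
    ring
  · refine Eq.trans (congrArg _ ?_) (maskSq_add_int q _ m)
    rw [hm]
    push_cast
    rw [pow_succ]
    field_simp
    rw [hbr]
    ring

theorem sum_wordWeight [NeZero q] {r b : ℕ} (hb : 1 < b) (hbqr : b = q * r)
    {τ : List (Fin q) → ℤ} (hτ : ∀ w i, τ (w ++ [i]) ∈ digitClass q b i)
    (w : List (Fin q)) (t : ℝ) :
    ∑ i : Fin q, wordWeight r b τ (w ++ [i]) t = wordWeight r b τ w t := by
  rw [Finset.sum_congr rfl fun i _ => wordWeight_concat hb hbqr w i (hτ w i).1 t,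
    ← Finset.mul_sum, sum_maskSq, mul_one]

/-- The full frequency agrees with the partial one modulo `b ^ n`, and the remaining factors are at
most one. -/
theorem fourierSq_le_wordWeight [NeZero q] {r b : ℕ} (hb : 1 < b)
    {τ : List (Fin q) → ℤ} {s : ℕ → Fin q} (hs : RegularOn τ s) (n : ℕ) (t : ℝ) :
    fourierSq q b (t + r * proj b τ s) ≤ wordWeight r b τ (prefixWord s n) t := by
  obtain ⟨z, hz⟩ := hs.exists_proj_eq_add (b := b) n
  rw [fourierSq_eq_maskProd_mul hb n]
  refine (mul_le_of_le_one_right (maskProd_nonneg _ _ _ _) (fourierSq_le_one _ _ _)).trans_eq ?_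
  unfold wordWeight
  rw [length_prefixWord, hz]
  refine Eq.trans (congrArg _ ?_) (maskProd_add_mul hb n _ (r * z))
  push_cast
  ring

theorem tendsto_wordWeight [NeZero q] {r b : ℕ} (hb : 1 < b)
    {τ : List (Fin q) → ℤ} {s : ℕ → Fin q} (hs : RegularOn τ s) (t : ℝ) :
    Tendsto (fun n => wordWeight r b τ (prefixWord s n) t) atTop
      (𝓝 (fourierSq q b (t + r * proj b τ s))) := by
  obtain ⟨N, hN⟩ := hs.exists_proj_eq (b := b)
  refine (tendsto_maskProd hb _).congr' ?_
  filter_upwards [eventually_ge_atTop N] with n hn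
  rw [wordWeight, length_prefixWord, hN n hn]

theorem pathMass_eq_sum [NeZero q] (r b : ℕ) (τ : List (Fin q) → ℤ) (w : List (Fin q)) (t : ℝ) :
    pathMass r b τ w t = ∑ i : Fin q, pathMass r b τ (w ++ [i]) t := by
  classical
  unfold pathMass
  rw [← Summable.tsum_finsetSum fun _ _ => ENNReal.summable]
  refine tsum_congr fun s => ?_
  have h : ∀ i, prefixWord s (w ++ [i]).length = w ++ [i] ↔
      prefixWord s w.length = w ∧ s w.length = i := by
    intro i
    rw [List.length_append, List.length_singleton, prefixWord_succ]
    constructor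
    · intro h
      have := List.append_inj' h rfl
      exact ⟨this.1, by simpa using this.2⟩
    · rintro ⟨h1, h2⟩
      rw [h1, h2]
  simp_rw [h, ← and_assoc]
  rw [Finset.sum_eq_single (s w.length)]
  · simp
  · intro i _ hi
    rw [if_neg fun h => hi h.2.symm]
  · simp

/-- Induction on the depth `m` below `w` at which the finitely many paths have separated: split by
the next letter until each word carries at most one path. -/
theorem sum_fourierSq_le [NeZero q] {r b : ℕ} (hb : 1 < b) (hbqr : b = q * r)
    {τ : List (Fin q) → ℤ} (hτ : ∀ w i, τ (w ++ [i]) ∈ digitClass q b i) (t : ℝ) (m : ℕ) :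
    ∀ (w : List (Fin q)) (F : Finset (ℕ → Fin q)), (∀ s ∈ F, RegularOn τ s) →
      (∀ s ∈ F, prefixWord s w.length = w) →
      Set.InjOn (fun s : ℕ → Fin q => prefixWord s (w.length + m)) F →
      ∑ s ∈ F, fourierSq q b (t + r * proj b τ s) ≤ wordWeight r b τ w t := by
  classical
  induction m with
  | zero =>
    intro w F hF hw hinj
    rcases F.eq_empty_or_nonempty with rfl | ⟨s, hs⟩
    · simpa using wordWeight_nonneg r b τ w t
    · have : F = {s} := Finset.eq_singleton_iff_unique_mem.2 ⟨hs, fun u hu =>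
        hinj hu hs (by simp [hw u hu, hw s hs])⟩
      rw [this, Finset.sum_singleton]
      have h := fourierSq_le_wordWeight (r := r) hb (hF s hs) w.length t
      rwa [hw s hs] at h
  | succ m ih =>
    intro w F hF hw hinj
    rw [← sum_wordWeight hb hbqr hτ w t,
      ← Finset.sum_fiberwise F (fun s : ℕ → Fin q => s w.length)]
    refine Finset.sum_le_sum fun i _ => ih (w ++ [i]) _ (fun s hs => hF s ?_) (fun s hs => ?_) ?_
    · exact (Finset.mem_filter.1 hs).1
    · rw [Finset.mem_filter] at hs
      rw [List.length_append, List.length_singleton, prefixWord_succ, hw s hs.1, hs.2]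
    · refine fun s hs u hu h => hinj (Finset.mem_filter.1 hs).1 (Finset.mem_filter.1 hu).1 ?_
      simpa [add_assoc, add_comm 1 m] using h

theorem exists_injOn_prefixWord (F : Finset (ℕ → Fin q)) :
    ∃ N, ∀ n, N ≤ n → Set.InjOn (fun s : ℕ → Fin q => prefixWord s n) F := by
  classical
  have h : ∀ p : (ℕ → Fin q) × (ℕ → Fin q), ∃ k, p.1 ≠ p.2 → p.1 k ≠ p.2 k := by
    intro p
    by_cases hp : p.1 = p.2
    · exact ⟨0, fun h => absurd hp h⟩
    · obtain ⟨k, hk⟩ := Function.ne_iff.1 hp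
      exact ⟨k, fun _ => hk⟩
  choose k hk using h
  refine ⟨(F ×ˢ F).sup k + 1, fun n hn s hs u hu hsu => ?_⟩
  by_contra hne
  have h1 : k (s, u) ≤ (F ×ˢ F).sup k := Finset.le_sup (Finset.mk_mem_product hs hu)
  exact hk (s, u) hne (prefixWord_inj.1 hsu _ (by omega))

theorem pathMass_le [NeZero q] {r b : ℕ} (hb : 1 < b) (hbqr : b = q * r)
    {τ : List (Fin q) → ℤ} (hτ : ∀ w i, τ (w ++ [i]) ∈ digitClass q b i)
    (w : List (Fin q)) (t : ℝ) :
    pathMass r b τ w t ≤ ENNReal.ofReal (wordWeight r b τ w t) := by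
  classical
  refine ENNReal.summable.tsum_le_of_sum_le fun F => ?_
  rw [← Finset.sum_filter, ← ENNReal.ofReal_sum_of_nonneg fun _ _ => fourierSq_nonneg _ _ _]
  refine ENNReal.ofReal_le_ofReal ?_
  obtain ⟨N, hN⟩ := exists_injOn_prefixWord F
  refine sum_fourierSq_le hb hbqr hτ t N w _ (fun s hs => ?_) (fun s hs => ?_)
    ((hN _ (Nat.le_add_left _ _)).mono fun s hs => ?_)
  · exact (Finset.mem_filter.1 hs).2.1.2
  · exact (Finset.mem_filter.1 hs).2.2
  · exact (Finset.mem_filter.1 hs).1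

/-- Mass and weight are both additive over children and mass is at most weight, so a deficit at one
child cannot be made up by the others. -/
theorem isFull_iff_forall_concat [NeZero q] {r b : ℕ} (hb : 1 < b) (hbqr : b = q * r)
    {τ : List (Fin q) → ℤ} (hτ : ∀ w i, τ (w ++ [i]) ∈ digitClass q b i) (w : List (Fin q)) :
    IsFull r b τ w ↔ ∀ i, IsFull r b τ (w ++ [i]) := by
  have hsum : ∀ t, ENNReal.ofReal (wordWeight r b τ w t) =
      ∑ i, ENNReal.ofReal (wordWeight r b τ (w ++ [i]) t) := fun t => by
    rw [← ENNReal.ofReal_sum_of_nonneg fun _ _ => wordWeight_nonneg _ _ _ _ _,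
      sum_wordWeight hb hbqr hτ]
  constructor
  · intro h i t
    have h1 := h t
    rw [pathMass_eq_sum, hsum] at h1
    by_contra hne
    rw [← Finset.add_sum_erase _ _ (Finset.mem_univ i),
      ← Finset.add_sum_erase _ _ (Finset.mem_univ i)] at h1
    have hle : ∑ j ∈ Finset.univ.erase i, pathMass r b τ (w ++ [j]) t ≤
        ∑ j ∈ Finset.univ.erase i, ENNReal.ofReal (wordWeight r b τ (w ++ [j]) t) :=
      Finset.sum_le_sum fun j _ => pathMass_le hb hbqr hτ _ t
    exact (ENNReal.add_lt_add_of_lt_of_le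
      (ne_top_of_le_ne_top (ENNReal.sum_ne_top.2 fun _ _ => ENNReal.ofReal_ne_top) hle)
      (lt_of_le_of_ne (pathMass_le hb hbqr hτ _ t) hne) hle).ne h1
  · intro h t
    rw [pathMass_eq_sum, hsum]
    exact Finset.sum_congr rfl fun i _ => h i t

theorem isFull_nil_iff [NeZero q] {r b : ℕ} (hb : 1 < b) (hbqr : b = q * r)
    {τ : List (Fin q) → ℤ} (hτ : ∀ w i, τ (w ++ [i]) ∈ digitClass q b i) :
    IsSpectrum (cantorMeasure q b) ((fun n : ℤ => (r : ℝ) * (n : ℝ)) '' Lam b τ) ↔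
      IsFull r b τ [] := by
  classical
  let R : Set (ℕ → Fin q) := {s | s ∈ Gam q ∧ RegularOn τ s}
  let f : R → ℝ := fun s => r * proj b τ s.1
  have hR : (fun n : ℤ => (r : ℝ) * (n : ℝ)) '' Lam b τ = Set.range f := by
    ext x
    constructor
    · rintro ⟨_, ⟨s, hs, hs', rfl⟩, rfl⟩
      exact ⟨⟨s, hs, hs'⟩, rfl⟩
    · rintro ⟨s, rfl⟩
      exact ⟨_, ⟨s.1, s.2.1, s.2.2, rfl⟩, rfl⟩
  have hmass : ∀ t, pathMass r b τ [] t = ∑' s : R, ENNReal.ofReal (fourierSq q b (t + f s)) := by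
    intro t
    rw [tsum_subtype R fun s => ENNReal.ofReal (fourierSq q b (t + r * proj b τ s))]
    refine tsum_congr fun s => ?_
    simp [Set.indicator_apply, R, prefixWord]
  -- `pathMass` counts paths while a spectrum counts frequencies. Two paths sharing a frequency
  -- would contribute `2` at `t = -f s`, more than the root weight `1`.
  have hinj : Function.Injective f := by
    intro s u hsu
    by_contra hne
    have h1 := pathMass_le hb hbqr hτ [] (-f s)
    rw [hmass, wordWeight_nil, ENNReal.ofReal_one] at h1
    have h2 := (ENNReal.sum_le_tsum ({s, u} : Finset R)).trans h1
    rw [Finset.sum_pair hne, ← hsu, neg_add_cancel, fourierSq_zero, ENNReal.ofReal_one,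
      one_add_one_eq_two] at h2
    norm_num at h2
  rw [hR, isSpectrum_iff]
  · refine forall_congr' fun t => ?_
    rw [hmass, wordWeight_nil, ENNReal.ofReal_one,
      ← (Equiv.ofInjective f hinj).tsum_eq fun s => ENNReal.ofReal (fourierSq q b (t + s))]
    simp
  · rw [← hR]
    exact (Set.to_countable _).image _

/-! ### Comparing two mappings below a word -/

theorem prefixWord_eq_append (s : ℕ → Fin q) {m n : ℕ} (h : m ≤ n) :
    prefixWord s n = prefixWord s m ++ (prefixWord s n).drop m := by
  conv_lhs => rw [← List.take_append_drop m (prefixWord s n), take_prefixWord s h]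

/-- Digits at `w` and its prefixes only add a common constant to all frequencies below `w`. This is
a translation of `t`, harmless because fullness quantifies over every `t`. -/
theorem IsFull.congr [NeZero q] {r b : ℕ} {τ τ' : List (Fin q) → ℤ} {w : List (Fin q)}
    (h : ∀ v, v ≠ [] → τ (w ++ v) = τ' (w ++ v)) (hw : IsFull r b τ w) : IsFull r b τ' w := by
  have key : ∀ s : ℕ → Fin q, prefixWord s w.length = w → ∀ k, w.length < k →
      τ (prefixWord s k) = τ' (prefixWord s k) := by
    intro s hs k hk
    rw [prefixWord_eq_append s hk.le, hs]
    refine h _ fun h0 => ?_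
    have := congrArg List.length h0
    rw [List.length_drop, length_prefixWord, List.length_nil] at this
    omega
  have hreg : ∀ s : ℕ → Fin q, prefixWord s w.length = w →
      (RegularOn τ s ↔ RegularOn τ' s) := by
    intro s hs
    constructor
    · rintro ⟨N, hN⟩
      exact ⟨max N (w.length + 1), fun k hk => by
        rw [← key s hs k (by omega)]; exact hN k (by omega)⟩
    · rintro ⟨N, hN⟩
      exact ⟨max N (w.length + 1), fun k hk => by
        rw [key s hs k (by omega)]; exact hN k (by omega)⟩
  have hproj : ∀ s : ℕ → Fin q, prefixWord s w.length = w → RegularOn τ s →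
      proj b τ' s = proj b τ s + (wordFreq b τ' w - wordFreq b τ w) := by
    intro s hs hr
    obtain ⟨N, hN⟩ := hr.exists_proj_eq (b := b)
    obtain ⟨N', hN'⟩ := ((hreg s hs).1 hr).exists_proj_eq (b := b)
    have e : ∀ σ : List (Fin q) → ℤ, wordFreq b σ (prefixWord s (w.length + (N + N'))) =
        wordFreq b σ w + ∑ k ∈ Finset.range (N + N'),
          σ (prefixWord s (w.length + k + 1)) * (b : ℤ) ^ (w.length + k) := by
      intro σ
      conv_rhs => rw [← hs]
      rw [wordFreq_prefixWord, wordFreq_prefixWord, Finset.sum_range_add, length_prefixWord]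
    have e' : ∀ k, τ (prefixWord s (w.length + k + 1)) = τ' (prefixWord s (w.length + k + 1)) :=
      fun k => key s hs _ (by omega)
    rw [hN (w.length + (N + N')) (by omega), hN' (w.length + (N + N')) (by omega), e, e]
    simp_rw [e']
    ring
  intro t
  have h1 := hw (t + r * ((wordFreq b τ' w - wordFreq b τ w : ℤ) : ℝ))
  have h2 : wordWeight r b τ (w) (t + r * ((wordFreq b τ' w - wordFreq b τ w : ℤ) : ℝ)) =
      wordWeight r b τ' w t := by
    unfold wordWeight
    congr 1
    push_cast
    ring
  rw [← h2, ← h1]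
  unfold pathMass
  refine tsum_congr fun s => ?_
  by_cases hs : prefixWord s w.length = w
  · by_cases hr : RegularOn τ s
    · have h3 : t + r * (proj b τ' s : ℝ) =
          t + r * ((wordFreq b τ' w - wordFreq b τ w : ℤ) : ℝ) + r * proj b τ s := by
        rw [hproj s hs hr]
        push_cast
        ring
      by_cases hG : s ∈ Gam q
      · rw [if_pos ⟨⟨hG, (hreg s hs).1 hr⟩, hs⟩, if_pos ⟨⟨hG, hr⟩, hs⟩, h3]
      · rw [if_neg fun h => hG h.1.1, if_neg fun h => hG h.1.1]
    · simp [hr, (hreg s hs).not.1 hr]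
  · simp [hs]

/-! ### Paths ending in zeros -/

theorem neg_pow_le_wordFreq {b : ℕ} (hb : 2 < b) {τ : List (Fin q) → ℤ}
    (hτ : ∀ w, -1 ≤ τ w) (s : ℕ → Fin q) (n : ℕ) :
    -(b : ℤ) ^ n ≤ wordFreq b τ (prefixWord s n) := by
  induction n with
  | zero => simp [wordFreq, prefixWord]
  | succ n ih =>
    rw [prefixWord_succ, wordFreq_concat, length_prefixWord, pow_succ]
    have hp : (0 : ℤ) < (b : ℤ) ^ n := by positivity
    have h := hτ (prefixWord s n ++ [s n])
    have hb' : (2 : ℤ) < b := by exact_mod_cast hb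
    nlinarith

theorem mul_wordFreq_le {b : ℕ} (hb : 2 < b) {τ : List (Fin q) → ℤ}
    (hτ : ∀ w, τ w ≤ b - 2) (s : ℕ → Fin q) (n : ℕ) :
    b * wordFreq b τ (prefixWord s n) ≤ (b - 1) * (b : ℤ) ^ n := by
  have hb' : (2 : ℤ) < b := by exact_mod_cast hb
  induction n with
  | zero =>
    simp [wordFreq, prefixWord]
    omega
  | succ n ih =>
    rw [prefixWord_succ, wordFreq_concat, length_prefixWord, pow_succ]
    have hp : (0 : ℤ) < (b : ℤ) ^ n := by positivity
    have h := hτ (prefixWord s n ++ [s n])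
    have h2 : (b * (b : ℤ) ^ n) * τ (prefixWord s n ++ [s n]) ≤ (b * (b : ℤ) ^ n) * (b - 2) :=
      mul_le_mul_of_nonneg_left h (by positivity)
    nlinarith

theorem exists_maskSq_le {δ : ℝ} (hq : 2 ≤ q) (h0 : 0 < δ) (h1 : δ ≤ 1 - δ) :
    ∃ ρ < 1, ∀ y ∈ Set.Icc δ (1 - δ), maskSq q y ≤ ρ := by
  obtain ⟨z, hz, hmax⟩ := isCompact_Icc.exists_isMaxOn (Set.nonempty_Icc.2 h1)
    (continuous_maskSq q).continuousOn
  exact ⟨maskSq q z, maskSq_lt_one hq (by linarith [hz.1]) (by linarith [hz.2]), fun y hy => hmax hy⟩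

theorem tendsto_zero_of_frequently_le {u : ℕ → ℝ} {ρ : ℝ} (hu : ∀ n, 0 ≤ u n) (ha : Antitone u)
    (hρ : ρ < 1) (h : ∃ᶠ n in atTop, u (n + 1) ≤ ρ * u n) : Tendsto u atTop (𝓝 0) := by
  have hlim := tendsto_atTop_ciInf ha ⟨0, by rintro _ ⟨n, rfl⟩; exact hu n⟩
  set l := ⨅ n, u n
  have hl : 0 ≤ l := ge_of_tendsto' hlim hu
  have h2 : l ≤ ρ * l := by
    by_contra hlt
    rw [not_le] at hlt
    have := (hlim.const_mul ρ).eventually_lt ((tendsto_add_atTop_iff_nat 1).2 hlim) hlt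
    obtain ⟨n, hn, hn'⟩ := (h.and_eventually this).exists
    linarith
  have : l = 0 := by nlinarith
  rwa [this] at hlim

/-- The weights are antitone, and each nonzero digit on the zero tail, once `t` is scaled down
enough, makes the next mask factor at most a fixed `ρ < 1`. Irregularity supplies infinitely many
such digits. -/
theorem tendsto_wordWeight_of_not_regularOn [NeZero q] {r b : ℕ} (hq : 2 ≤ q) (hb : 2 < b)
    (hbqr : b = q * r) {τ : List (Fin q) → ℤ}
    (hdig : ∀ w, τ w ∈ Set.Icc (-1 : ℤ) (b - 2)) (hτ : ∀ w i, τ (w ++ [i]) ∈ digitClass q b i)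
    {s : ℕ → Fin q} {N : ℕ} (hs : ∀ n, N ≤ n → s n = 0) (hirr : ¬ RegularOn τ s) (t : ℝ) :
    Tendsto (fun n => wordWeight r b τ (prefixWord s n) t) atTop (𝓝 0) := by
  have hb1 : 1 < b := by omega
  have hbp : (0 : ℝ) < b := by positivity
  have hqp : (0 : ℝ) < q := by positivity
  have hbr : (b : ℝ) = q * r := by exact_mod_cast hbqr
  have hstep : ∀ n, wordWeight r b τ (prefixWord s (n + 1)) t =
      wordWeight r b τ (prefixWord s n) t * maskSq q ((t + r * wordFreq b τ (prefixWord s n)) /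
        (b : ℝ) ^ (n + 1) + ((s n : ℕ) : ℝ) / q) := by
    intro n
    rw [prefixWord_succ, wordWeight_concat hb1 hbqr _ _ (hτ _ _).1, length_prefixWord]
  have hb2 : (2 : ℝ) ≤ b := by exact_mod_cast hb.le
  have hq1 : (1 : ℝ) ≤ q := by exact_mod_cast hq.trans' one_le_two
  -- The frequency part of the mask argument will lie in `[2δ, 1/q - 2δ]` with `δ = 1 / (2 * b *
  -- q)`; the spare `δ` at each end absorbs the vanishing contribution of `t`.
  have hδ : (0 : ℝ) < 1 / (2 * b * q) := by positivity
  have hδ2 : (1 : ℝ) / (2 * b * q) ≤ 1 / 2 := by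
    rw [div_le_div_iff₀ (by positivity) (by positivity)]
    nlinarith
  obtain ⟨ρ, hρ, hmask⟩ := exists_maskSq_le hq hδ (by linarith)
  refine tendsto_zero_of_frequently_le (fun n => wordWeight_nonneg _ _ _ _ _)
    (antitone_nat_of_succ_le fun n => ?_) hρ ?_
  · rw [hstep]
    exact mul_le_of_le_one_right (wordWeight_nonneg _ _ _ _ _) (maskSq_le_one _ _)
  · rw [frequently_atTop]
    intro A
    have hlim := (tendsto_div_pow hb1 t).abs
    rw [abs_zero] at hlim
    have hsmall := hlim.eventually_le_const hδ
    obtain ⟨B, hB⟩ := eventually_atTop.1 hsmall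
    have hne : ∃ k, A + B + N + 1 ≤ k ∧ τ (prefixWord s k) ≠ 0 := by
      by_contra hcon
      push Not at hcon
      exact hirr ⟨_, hcon⟩
    obtain ⟨k, hk, hk0⟩ := hne
    obtain ⟨n, rfl⟩ : ∃ n, k = n + 1 := ⟨k - 1, by omega⟩
    refine ⟨n + 1, by omega, ?_⟩
    rw [hstep (n + 1), mul_comm]
    refine mul_le_mul_of_nonneg_right (hmask _ ?_) (wordWeight_nonneg _ _ _ _ _)
    have hz : s (n + 1) = 0 := hs _ (by omega)
    -- After letter `0` the digit is a multiple of `q ≥ 2`; being nonzero and at least `-1`, it is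
    -- positive. It thus outweighs the lower bound `-b ^ n` for the earlier digits.
    have hτ2 : 2 ≤ τ (prefixWord s (n + 1)) := by
      obtain ⟨m, hm⟩ := (hτ (prefixWord s n) (s n)).1
      rw [← prefixWord_succ, hs n (by omega)] at hm
      have hm' : τ (prefixWord s (n + 1)) = q * m := by simpa using hm
      have h1 := (hdig (prefixWord s (n + 1))).1
      rw [hm'] at h1 hk0 ⊢
      have hq' : (2 : ℤ) ≤ q := by exact_mod_cast hq
      have hm1 : 0 < m := by
        rcases lt_trichotomy m 0 with h | h | h
        · nlinarith
        · simp [h] at hk0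
        · exact h
      nlinarith
    have hlow : (b : ℤ) ^ n ≤ wordFreq b τ (prefixWord s (n + 1)) := by
      have h1 := neg_pow_le_wordFreq hb (fun w => (hdig w).1) s n
      have hp : (0 : ℤ) < (b : ℤ) ^ n := by positivity
      rw [prefixWord_succ] at hτ2
      rw [prefixWord_succ, wordFreq_concat, length_prefixWord]
      nlinarith
    have hupp := mul_wordFreq_le hb (fun w => (hdig w).2) s (n + 1)
    have hlow' : (b : ℝ) ^ n ≤ wordFreq b τ (prefixWord s (n + 1)) := by exact_mod_cast hlow
    have hupp' : b * (wordFreq b τ (prefixWord s (n + 1)) : ℝ) ≤ (b - 1) * (b : ℝ) ^ (n + 1) := by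
      exact_mod_cast hupp
    have harg : (t + r * wordFreq b τ (prefixWord s (n + 1))) / (b : ℝ) ^ (n + 1 + 1) +
        ((s (n + 1) : ℕ) : ℝ) / q = t / (b : ℝ) ^ (n + 1 + 1) +
          wordFreq b τ (prefixWord s (n + 1)) / (q * (b : ℝ) ^ (n + 1)) := by
      rw [hz, add_div, pow_succ (b : ℝ) (n + 1)]
      simp only [Fin.val_zero, Nat.cast_zero, zero_div, add_zero]
      congr 1
      rw [div_eq_div_iff (by positivity) (by positivity), hbr]
      ring
    rw [harg]
    have hsm := abs_le.1 (hB (n + 1 + 1) (by omega))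
    have h1 : 1 / (b * q) ≤ wordFreq b τ (prefixWord s (n + 1)) / (q * (b : ℝ) ^ (n + 1)) := by
      rw [div_le_div_iff₀ (by positivity) (by positivity), pow_succ]
      nlinarith [mul_le_mul_of_nonneg_left hlow' (mul_pos hqp hbp).le]
    have h2 : wordFreq b τ (prefixWord s (n + 1)) / (q * (b : ℝ) ^ (n + 1)) ≤
        1 / q - 1 / (b * q) := by
      rw [div_le_iff₀ (by positivity)]
      have : (1 / q - 1 / (b * q)) * (q * (b : ℝ) ^ (n + 1)) =
          (b - 1) * (b : ℝ) ^ (n + 1) / b := by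
        field_simp
      rw [this, le_div_iff₀ hbp]
      linarith
    have h3 : (1 : ℝ) / (b * q) = 1 / (2 * b * q) + 1 / (2 * b * q) := by
      field_simp
      norm_num
    have h4 : (1 : ℝ) / q ≤ 1 := by
      rw [div_le_one hqp]
      exact hq1
    constructor <;> linarith [hsm.1, hsm.2]

theorem zeroExtend_prefixWord [NeZero q] {s : ℕ → Fin q} {N : ℕ} (hs : ∀ n, N ≤ n → s n = 0) :
    zeroExtend (prefixWord s N) = s := by
  funext n
  unfold zeroExtend
  by_cases h : n < N
  · rw [List.getD_eq_getElem _ _ (by rwa [length_prefixWord])]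
    simp [prefixWord]
  · rw [List.getD_eq_default _ _ (by rw [length_prefixWord]; omega), hs n (by omega)]

theorem mem_Gam_iff [NeZero q] {s : ℕ → Fin q} : s ∈ Gam q ↔ ∃ N, ∀ n, N ≤ n → s n = 0 := by
  constructor
  · rintro ⟨I, -, rfl⟩
    exact ⟨I.length, fun n hn => List.getD_eq_default _ _ hn⟩
  · rintro ⟨N, hN⟩
    induction N with
    | zero => exact ⟨[], fun h => absurd rfl h, (zeroExtend_prefixWord hN).symm⟩
    | succ N ih =>
      by_cases h0 : s N = 0
      · refine ih fun n hn => ?_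
        rcases hn.eq_or_lt with rfl | h
        · exact h0
        · exact hN n h
      · refine ⟨prefixWord s (N + 1), fun h => ?_, (zeroExtend_prefixWord hN).symm⟩
        simpa [prefixWord_succ] using h0

theorem zeroExtend_of_length_le [NeZero q] (w : List (Fin q)) {n : ℕ} (h : w.length ≤ n) :
    zeroExtend w n = 0 := List.getD_eq_default _ _ h

theorem zeroExtend_mem_Gam [NeZero q] (w : List (Fin q)) : zeroExtend w ∈ Gam q :=
  mem_Gam_iff.2 ⟨w.length, fun _ => zeroExtend_of_length_le w⟩

theorem prefixWord_zeroExtend [NeZero q] (w : List (Fin q)) (n : ℕ) :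
    prefixWord (zeroExtend w) (w.length + n) = w ++ List.replicate n 0 := by
  refine List.ext_getElem (by simp [prefixWord]) fun k h1 h2 => ?_
  rw [List.getElem_append]
  simp only [prefixWord, List.getElem_map, List.getElem_range, zeroExtend]
  split_ifs with h
  · rw [List.getD_eq_getElem _ _ h]
  · rw [List.getD_eq_default _ _ (by omega), List.getElem_replicate]

/-- When all side branches are full, any deficit of `w` must persist undiminished along `w 0^∞`. The
limiting weight there is either the mass of that very path or zero, which leaves no room for a
deficit. -/
theorem isFull_iff_forall_zeros [NeZero q] {r b : ℕ} (hq : 2 ≤ q) (hb : 2 < b)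
    (hbqr : b = q * r) {τ : List (Fin q) → ℤ}
    (hdig : ∀ w, τ w ∈ Set.Icc (-1 : ℤ) (b - 2)) (hτ : ∀ w i, τ (w ++ [i]) ∈ digitClass q b i)
    (w : List (Fin q)) :
    IsFull r b τ w ↔ ∀ k i, i ≠ 0 → IsFull r b τ (w ++ List.replicate k 0 ++ [i]) := by
  have hb1 : 1 < b := by omega
  have hchild := isFull_iff_forall_concat (r := r) hb1 hbqr hτ
  have hrep : ∀ k, w ++ List.replicate (k + 1) (0 : Fin q) = w ++ List.replicate k 0 ++ [0] :=
    fun k => by rw [List.replicate_succ', List.append_assoc]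
  constructor
  · intro h k i _
    have : ∀ k, IsFull r b τ (w ++ List.replicate k 0) := by
      intro k
      induction k with
      | zero => simpa using h
      | succ k ih => exact hrep k ▸ (hchild _).1 ih 0
    exact (hchild _).1 (this k) i
  · intro h t
    have hfin : ∀ v, pathMass r b τ v t ≠ ⊤ := fun v =>
      ne_top_of_le_ne_top ENNReal.ofReal_ne_top (pathMass_le hb1 hbqr hτ v t)
    have hgap : ∀ n, wordWeight r b τ w t - (pathMass r b τ w t).toReal =
        wordWeight r b τ (w ++ List.replicate n 0) t -
          (pathMass r b τ (w ++ List.replicate n 0) t).toReal := by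
      intro n
      induction n with
      | zero => simp
      | succ n ih =>
        have hrest : ∀ i ∈ Finset.univ.erase (0 : Fin q),
            (pathMass r b τ (w ++ List.replicate n 0 ++ [i]) t).toReal =
              wordWeight r b τ (w ++ List.replicate n 0 ++ [i]) t := fun i hi => by
          rw [h n i (Finset.ne_of_mem_erase hi) t,
            ENNReal.toReal_ofReal (wordWeight_nonneg _ _ _ _ _)]
        rw [ih, hrep, pathMass_eq_sum r b τ (w ++ List.replicate n 0),
          ENNReal.toReal_sum fun i _ => hfin _,
          ← sum_wordWeight hb1 hbqr hτ (w ++ List.replicate n 0),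
          ← Finset.add_sum_erase _ _ (Finset.mem_univ (0 : Fin q)),
          ← Finset.add_sum_erase _ (fun i => (pathMass r b τ _ t).toReal)
            (Finset.mem_univ (0 : Fin q)), Finset.sum_congr rfl hrest]
        ring
    -- In the regular case `l` is the term of the path `w 0^∞`, which is counted in every `pathMass`
    -- along it; in the irregular case `l = 0`.
    obtain ⟨l, hl0, hl, hlim⟩ : ∃ l : ℝ, 0 ≤ l ∧
        (∀ n, l ≤ (pathMass r b τ (w ++ List.replicate n 0) t).toReal) ∧
        Tendsto (fun n => wordWeight r b τ (w ++ List.replicate n 0) t) atTop (𝓝 l) := by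
      have hshift : ∀ n, prefixWord (zeroExtend w) (n + w.length) = w ++ List.replicate n 0 :=
        fun n => by rw [add_comm, prefixWord_zeroExtend]
      by_cases hreg : RegularOn τ (zeroExtend w)
      · refine ⟨_, fourierSq_nonneg _ _ _, fun n => ?_,
          ((tendsto_wordWeight (r := r) hb1 hreg t).comp (tendsto_add_atTop_nat w.length)).congr
            fun n => by rw [Function.comp_apply, hshift]⟩
        rw [← ENNReal.toReal_ofReal (fourierSq_nonneg _ _ _)]
        refine ENNReal.toReal_mono (hfin _) ?_
        refine le_trans (le_of_eq ?_) (ENNReal.le_tsum (zeroExtend w))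
        rw [if_pos ⟨⟨zeroExtend_mem_Gam w, hreg⟩, by simp [prefixWord_zeroExtend]⟩]
      · exact ⟨0, le_rfl, fun n => ENNReal.toReal_nonneg,
          ((tendsto_wordWeight_of_not_regularOn (r := r) hq hb hbqr hdig hτ
            (fun n => zeroExtend_of_length_le w) hreg t).comp
              (tendsto_add_atTop_nat w.length)).congr
            fun n => by rw [Function.comp_apply, hshift]⟩
    have hle : wordWeight r b τ w t - (pathMass r b τ w t).toReal ≤ 0 := by
      have h1 := hlim.sub_const l
      rw [sub_self] at h1
      refine ge_of_tendsto' h1 fun n => ?_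
      rw [hgap n]
      linarith [hl n]
    refine le_antisymm (pathMass_le hb1 hbqr hτ w t) ?_
    exact ENNReal.ofReal_le_of_le_toReal (by linarith)

/-! ### The regularized mapping -/

theorem isFull_nil_iff_forall_length [NeZero q] {r b : ℕ} (hb : 1 < b) (hbqr : b = q * r)
    {τ : List (Fin q) → ℤ} (hτ : ∀ w i, τ (w ++ [i]) ∈ digitClass q b i) (n : ℕ) :
    IsFull r b τ [] ↔ ∀ w : List (Fin q), w.length = n → IsFull r b τ w := by
  induction n with
  | zero => simp
  | succ n ih =>
    rw [ih]
    constructor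
    · intro h w hw
      have hne : w ≠ [] := by
        rintro rfl
        simp at hw
      rw [← List.dropLast_append_getLast hne]
      exact (isFull_iff_forall_concat hb hbqr hτ _).1 (h _ (by simp [hw])) _
    · intro h w hw
      exact (isFull_iff_forall_concat hb hbqr hτ _).2 fun i => h _ (by simp [hw])

theorem regularize_eq_zero_or [NeZero q] (τ : List (Fin q) → ℤ) (w : List (Fin q)) :
    regularize τ w = 0 ∨ regularize τ w = τ w := by
  unfold regularize
  split_ifs <;> simp

theorem regularOn_regularize [NeZero q] (τ : List (Fin q) → ℤ) {s : ℕ → Fin q}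
    (hs : s ∈ Gam q) : RegularOn (regularize τ) s := by
  by_cases hreg : RegularOn τ s
  · obtain ⟨N, hN⟩ := hreg
    refine ⟨N, fun k hk => ?_⟩
    rcases regularize_eq_zero_or τ (prefixWord s k) with h | h
    · exact h
    · rw [h, hN k hk]
  · obtain ⟨I, hI, rfl⟩ := hs
    refine ⟨I.length + 1, fun k hk => ?_⟩
    obtain ⟨m, rfl⟩ := Nat.exists_eq_add_of_le (show I.length ≤ k by omega)
    unfold regularize
    rw [if_pos ⟨I, m, hI, ⟨zeroExtend_mem_Gam I, hreg⟩, by omega, prefixWord_zeroExtend I m⟩]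

theorem IsMaximalMapping.regularize [NeZero q] {b : ℕ} (hb : 2 < b) {τ : List (Fin q) → ℤ}
    (hτ : IsMaximalMapping b τ) : IsMaximalMapping b (regularize τ) where
  mem_digits w := by
    rcases regularize_eq_zero_or τ w with h | h <;> rw [h]
    · constructor <;> omega
    · exact hτ.mem_digits w
  root := by
    rcases regularize_eq_zero_or τ [] with h | h <;> rw [h]
    exact hτ.root
  zeros n hn := by
    rcases regularize_eq_zero_or τ (List.replicate n 0) with h | h <;> rw [h]
    exact hτ.zeros n hn
  mem_class w i := by
    by_cases hc : ∃ (I : List (Fin q)) (k : ℕ), LastNonzero I ∧ zeroExtend I ∈ irregularPaths τ ∧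
        1 ≤ k ∧ w ++ [i] = I ++ List.replicate k 0
    · rw [CantorSpectra.regularize, if_pos hc]
      obtain ⟨I, k, -, -, hk, h⟩ := hc
      -- As `k ≥ 1`, a modified word ends in the letter `0`, whose digit class contains the new
      -- value `0`.
      obtain ⟨m, rfl⟩ : ∃ m, k = m + 1 := ⟨k - 1, by omega⟩
      rw [List.replicate_succ', ← List.append_assoc] at h
      have hi : i = 0 := by simpa using (List.append_inj' h rfl).2
      subst hi
      exact ⟨⟨0, by simp⟩, by constructor <;> omega⟩
    · rw [CantorSpectra.regularize, if_neg hc]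
      exact hτ.mem_class w i
  exists_regular w := ⟨[], zeroExtend_mem_Gam _, regularOn_regularize τ (zeroExtend_mem_Gam _)⟩

theorem exists_length_le_of_finite_irregularPaths [NeZero q] {τ : List (Fin q) → ℤ}
    (hfin : (irregularPaths τ).Finite) :
    ∃ N, ∀ I : List (Fin q), LastNonzero I → zeroExtend I ∈ irregularPaths τ → I.length ≤ N := by
  have h : ∀ s : ℕ → Fin q, ∃ N, s ∈ irregularPaths τ → ∀ n, N ≤ n → s n = 0 := by
    intro s
    by_cases hs : s ∈ irregularPaths τ
    · obtain ⟨N, hN⟩ := mem_Gam_iff.1 hs.1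
      exact ⟨N, fun _ => hN⟩
    · exact ⟨0, fun h => absurd h hs⟩
  choose N hN using h
  refine ⟨hfin.toFinset.sup N, fun I hI hmem => ?_⟩
  refine le_trans ?_ (Finset.le_sup (hfin.mem_toFinset.2 hmem))
  by_contra hlt
  rw [not_le] at hlt
  have hne : I ≠ [] := by
    rintro rfl
    simp at hlt
  -- If `I` were longer than the bound, its last letter would already lie in the zero tail.
  have h0 := hN _ hmem (I.length - 1) (by omega)
  refine hI hne ?_
  rw [List.getLast_eq_getElem, ← h0, zeroExtend, List.getD_eq_getElem]

/-- A modified word has only zeros from position `N` on, whereas these words carry `i ≠ 0` at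
position `w.length ≥ N`. -/
theorem regularize_append_eq [NeZero q] {τ : List (Fin q) → ℤ} {N : ℕ}
    (hN : ∀ I : List (Fin q), LastNonzero I → zeroExtend I ∈ irregularPaths τ → I.length ≤ N)
    {w : List (Fin q)} (hw : N ≤ w.length) {i : Fin q} (hi : i ≠ 0) (v : List (Fin q)) :
    regularize τ (w ++ [i] ++ v) = τ (w ++ [i] ++ v) := by
  unfold regularize
  refine if_neg ?_
  rintro ⟨I, k, hI, hmem, -, h⟩
  have hlen := (hN I hI hmem).trans hw
  have h1 := congrArg (fun l : List (Fin q) => l.getD w.length 0) h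
  have h2 : (w ++ [i] ++ v).getD w.length 0 = i := by simp
  have h3 : (I ++ List.replicate k (0 : Fin q)).getD w.length 0 = 0 := by
    rw [List.getD_append_right _ _ _ _ hlen]
    simp only [List.getD_eq_getElem?_getD, List.getElem?_replicate]
    split_ifs <;> simp
  exact hi (h2.symm.trans (h1.trans h3))

theorem isFull_nil_regularize_iff [NeZero q] {r b : ℕ} (hq : 2 ≤ q) (hb : 2 < b)
    (hbqr : b = q * r) {τ : List (Fin q) → ℤ} (hτ : IsMaximalMapping b τ)
    (hfin : (irregularPaths τ).Finite) :
    IsFull r b τ [] ↔ IsFull r b (regularize τ) [] := by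
  have hb1 : 1 < b := by omega
  have hR := hτ.regularize hb
  obtain ⟨N, hN⟩ := exists_length_le_of_finite_irregularPaths hfin
  rw [isFull_nil_iff_forall_length hb1 hbqr hτ.mem_class N,
    isFull_nil_iff_forall_length hb1 hbqr hR.mem_class N]
  refine forall₂_congr fun w hw => ?_
  rw [isFull_iff_forall_zeros hq hb hbqr hτ.mem_digits hτ.mem_class,
    isFull_iff_forall_zeros hq hb hbqr hR.mem_digits hR.mem_class]
  refine forall₃_congr fun k i hi => ?_
  have heq := regularize_append_eq hN (w := w ++ List.replicate k 0)
    (by rw [List.length_append]; omega) hi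
  exact ⟨IsFull.congr fun v _ => (heq v).symm, IsFull.congr fun v _ => heq v⟩

/-- With one letter all words are powers of `0`, where a maximal mapping vanishes anyway. This
settles `q = 1`, for which the mask is identically one and no contraction is available. -/
theorem regularize_eq_self_of_subsingleton [NeZero q] [Subsingleton (Fin q)] {b : ℕ}
    {τ : List (Fin q) → ℤ} (hτ : IsMaximalMapping b τ) : regularize τ = τ := by
  funext w
  have hw : τ w = 0 := by
    rcases w.eq_nil_or_concat with rfl | ⟨v, i, rfl⟩
    · exact hτ.root
    · have h : v.concat i = List.replicate (v.concat i).length 0 :=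
        List.eq_replicate_iff.2 ⟨rfl, fun a _ => Subsingleton.elim a 0⟩
      rw [h]
      exact hτ.zeros _ (by simp)
  rcases regularize_eq_zero_or τ w with h | h
  · rw [h, hw]
  · exact h

end CantorSpectra

theorem theorem2 (q r b : ℕ) [NeZero q] (hb : 2 < b) (hqb : q < b) (hbqr : b = q * r)
    (τ : List (Fin q) → ℤ) (hτ : IsMaximalMapping b τ) (hfin : (irregularPaths τ).Finite) :
    IsSpectralMapping r b τ ↔ IsSpectralMapping r b (regularize τ) := by
  have hb1 : 1 < b := by omega
  rcases Nat.lt_or_ge 1 q with hq | hq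
  · have hR := hτ.regularize hb
    rw [IsSpectralMapping, IsSpectralMapping, isFull_nil_iff hb1 hbqr hτ.mem_class,
      isFull_nil_iff hb1 hbqr hR.mem_class, isFull_nil_regularize_iff hq hb hbqr hτ hfin]
    simp only [hτ, hR, true_and]
  · have : Subsingleton (Fin q) := Fin.subsingleton_iff_le_one.2 hq
    rw [regularize_eq_self_of_subsingleton hτ]
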